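/- **Setting.** An MDP $\mathcal M=(S,\mathit{Act},P,\mathsf{AP},L)$ has a non-empty finite state set $S$, a finite action set $\mathit{Act}$, transition probabilities $P(s,\alpha,s')\in[0,1]$ such that $\sum_{s'}P(s,\alpha,s')$ is $1$ (then $\alpha$ is enabled, $\alpha\in\mathit{Act}(s)$) or $0$, with $\mathit{Act}(s)\neq\emptyset$ for all $s$, and a labelling $L:S\to 2^{\mathsf{AP}}$. A non-probabilistic memoryless scheduler is a map $\sigma:S\to\mathit{Act}$ with $\sigma(s)\in\mathit{Act}(s)$. The $n$-ary self-composition $\mathcal M^\sigma_n$ is the Markov chain on $S^n$ with transition probabilities $\prod_i P(s_i,\sigma(s_i),s_i')$ in which $a_{i}$ holds in $\vec s$ iff $a\in L(s_i)$. Let $\mathrm{supp}_{\vec s}(\vec\alpha)=\prod_i\{s':P(s_i,\alpha_i,s')>0\}$. Quantifier-free formulas, probability expressions and path formulas are given by $\varphi::=\mathtt{true}\mid a_{\hat s_i}\mid\varphi\wedge\varphi\mid\neg\varphi\mid e<e$, $\;e::=\mathbb P(\psi)\mid c\mid e+e\mid e-e\mid e*e$ $(c\in\mathbb R)$, $\;\psi::=\mathsf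 X\varphi\mid\varphi\,\mathcal U\,\varphi\mid\varphi\,\mathcal U^{[k_1,k_2]}\varphi$ $(k_1\le k_2)$, $1\le i\le n$, interpreted as usual in the states and on the infinite paths of $\mathcal M^\sigma_n$; $\mathbb P(\psi)$ is the probability of the paths from the current state that satisfy $\psi$. The input formula is $\Phi=Q\hat\sigma.\,Q_1\hat s_1(\hat\sigma)\ldots Q_n\hat s_n(\hat\sigma).\,\varphi$ with $Q,Q_i\in\{\exists,\forall\}$; $\mathcal M\models\Phi$ means that for some (resp. all) non-probabilistic memoryless $\sigma$ the quantified states $Q_1s_1\in S\ldots Q_ns_n\in S$ are such that $(s_1,\dots,s_n)$ satisfies $\varphi$ in $\mathcal M^\sigma_n$. **Encoding.** The SMT variables are $\sigma_s\in\mathit{Act}$; propositions $h_{\vec s,\varphi}$; $p_{\vec s,e}$, ranging over $[0,1]$ if $e=\mathbb P(\psi)$ and over $\mathbb R$ otherwise; $t_{\vec s,\varphi}\in\{0,1\}$; and $d_{\vec s,\varphi}\in D$, where $D$ is a linear order with at least $|S|^n$ elements. $\mathrm{Sem}(\cdot)$ is the conjunction of $\mathrm{Sem}$ of the immediate sub-formulas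 and sub-expressions with the following constraints for all $\vec s\in S^n$ and all $\vec\alpha\in\prod_i\mathit{Act}(s_i)$, where $\mathrm{ch}_{\vec\alpha}:=\bigwedge_i\sigma_{s_i}=\alpha_i$ and $\Sigma_{\vec\alpha}x:=\sum_{\vec s'\in\mathrm{supp}_{\vec s}(\vec\alpha)}\prod_iP(s_i,\alpha_i,s_i')\cdot x_{\vec s'}$: - $h_{\vec s,\mathtt{true}}$; $\;h_{\vec s,a_{\hat s_i}}$ if $a\in L(s_i)$ and $\neg h_{\vec s,a_{\hat s_i}}$ otherwise; $\;h_{\vec s,\varphi_1\wedge\varphi_2}\leftrightarrow(h_{\vec s,\varphi_1}\wedge h_{\vec s,\varphi_2})$; $\;h_{\vec s,\neg\varphi}\oplus h_{\vec s,\varphi}$; $\;h_{\vec s,e_1<e_2}\leftrightarrow p_{\vec s,e_1}<p_{\vec s,e_2}$; $\;p_{\vec s,c}=c$; $\;p_{\vec s,e_1\circ e_2}=p_{\vec s,e_1}\circ p_{\vec s,e_2}$ for $\circ\in\{+,-,*\}$. - $e=\mathbb P(\mathsf X\varphi)$: $(t_{\vec s,\varphi}=1\wedge h_{\vec s,\varphi})\vee(t_{\vec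 s,\varphi}=0\wedge\neg h_{\vec s,\varphi})$, and $\mathrm{ch}_{\vec\alpha}\to p_{\vec s,e}=\Sigma_{\vec\alpha}t_{\cdot,\varphi}$. - $e=\mathbb P(\varphi_1\,\mathcal U\,\varphi_2)$: $h_{\vec s,\varphi_2}\to p_{\vec s,e}=1$; $(\neg h_{\vec s,\varphi_1}\wedge\neg h_{\vec s,\varphi_2})\to p_{\vec s,e}=0$; and $(h_{\vec s,\varphi_1}\wedge\neg h_{\vec s,\varphi_2}\wedge\mathrm{ch}_{\vec\alpha})\to\big[p_{\vec s,e}=\Sigma_{\vec\alpha}p_{\cdot,e}\wedge\big(p_{\vec s,e}>0\to\bigvee_{\vec s'\in\mathrm{supp}_{\vec s}(\vec\alpha)}(h_{\vec s',\varphi_2}\vee d_{\vec s,\varphi_2}>d_{\vec s',\varphi_2})\big)\big]$. - $e=\mathbb P(\varphi_1\,\mathcal U^{[k_1,k_2]}\varphi_2)$: if $k_2=0$: $h_{\vec s,\varphi_2}\to p_{\vec s,e}=1$ and $\neg h_{\vec s,\varphi_2}\to p_{\vec s,e}=0$. If $0=k_1<k_2$, with $e'=\mathbb P(\varphi_1\,\mathcal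 U^{[0,k_2-1]}\varphi_2)$: the constraints for $e'$; $h_{\vec s,\varphi_2}\to p_{\vec s,e}=1$; $(\neg h_{\vec s,\varphi_1}\wedge\neg h_{\vec s,\varphi_2})\to p_{\vec s,e}=0$; $(h_{\vec s,\varphi_1}\wedge\neg h_{\vec s,\varphi_2}\wedge\mathrm{ch}_{\vec\alpha})\to p_{\vec s,e}=\Sigma_{\vec\alpha}p_{\cdot,e'}$. If $k_1>0$, with $e'=\mathbb P(\varphi_1\,\mathcal U^{[k_1-1,k_2-1]}\varphi_2)$: the constraints for $e'$; $\neg h_{\vec s,\varphi_1}\to p_{\vec s,e}=0$; $(h_{\vec s,\varphi_1}\wedge\mathrm{ch}_{\vec\alpha})\to p_{\vec s,e}=\Sigma_{\vec\alpha}p_{\cdot,e'}$. $\mathrm{Truth}(Q_1\ldots Q_n,\varphi)$ is $B_1\ldots B_n\,h_{(s_1,\dots,s_n),\varphi}$ with $B_i=\bigwedge_{s_i\in S}$ if $Q_i=\forall$ and $B_i=\bigvee_{s_i\in S}$ if $Q_i=\exists$. Let $\mathrm{Sched}=\bigwedge_{s\in S}\bigvee_{\alpha\in\mathit{Act}(s)}\sigma_s=\alpha$.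 The algorithm forms $E=\mathrm{Sched}\wedge\mathrm{Sem}(\varphi)\wedge\mathrm{Truth}(Q_1\ldots Q_n,\varphi)$ if $Q=\exists$ and returns TRUE iff $E$ is satisfiable; if $Q=\forall$ it forms $E=\mathrm{Sched}\wedge\mathrm{Sem}(\neg\varphi)\wedge\mathrm{Truth}(\overline Q_1\ldots\overline Q_n,\neg\varphi)$ with the dual quantifiers $\overline Q_i$ and returns TRUE iff $E$ is unsatisfiable. **Theorem.** For every MDP $\mathcal M$ and every input formula $\Phi$: 1. the algorithm returns TRUE iff $\mathcal M\models\Phi$; that is, if $Q=\exists$ then $E$ is satisfiable iff $\mathcal M\models\Phi$, and if $Q=\forall$ then $E$ is unsatisfiable iff $\mathcal M\models\Phi$; 2. in every solution of $E$ the values of the $\sigma_s$ form a scheduler $\sigma$, and for every expression $e=\mathbb P(\varphi_1\,\mathcal U\,\varphi_2)$ that occurs in $\varphi$, the function $\vec s\mapsto p_{\vec s,e}$ is the least function $x:S^n\to[0,1]$ such that $x_{\vec s}=1$ if $\vec s\models\varphi_2$, $x_{\vec s}=0$ if $\vec s\not\models\varphi_1$ and $\vec s\not\models\varphi_2$, and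 $x_{\vec s}=\sum_{\vec s'}\prod_iP(s_i,\sigma(s_i),s'_i)\,x_{\vec s'}$ otherwise (satisfaction in $\mathcal M^\sigma_n$), and $p_{\vec s,e}$ is the probability of $\varphi_1\,\mathcal U\,\varphi_2$ from $\vec s$ in $\mathcal M^\sigma_n$. -/

import Mathlib

namespace HyperPCTL

open MeasureTheory ProbabilityTheory
open scoped BigOperators

/-! ### Markov models -/

/-- A Markov decision process with (finite) state set `S`, (finite) action set `Act` and atomic
propositions `AP`. For every state and action the outgoing probabilities sum to `1` (the action is
enabled) or to `0` (it is not), and every state has an enabled action. -/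
structure MDP (S Act AP : Type*) [Fintype S] where
  P : S → Act → S → ℝ
  P_mem : ∀ s α s', P s α s' ∈ Set.Icc (0 : ℝ) 1
  sum_P : ∀ s α, ∑ s', P s α s' = 1 ∨ ∑ s', P s α s' = 0
  exists_enabled : ∀ s, ∃ α, ∑ s', P s α s' = 1
  L : S → Set AP

/-- A labelled discrete-time Markov chain with (finite) state set `T`. -/
structure DTMC (T AP : Type*) [Fintype T] where
  P : T → T → ℝ
  nonneg : ∀ t t', 0 ≤ P t t'
  sum_P : ∀ t, ∑ t', P t t' = 1
  L : T → Set AP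

section Models

variable {S Act AP T : Type*} [Fintype S] [Fintype T]

open Classical in
/-- `Act(s)`: the actions enabled in `s`. -/
noncomputable def MDP.enabled [Fintype Act] (M : MDP S Act AP) (s : S) : Finset Act :=
  Finset.univ.filter fun α => ∑ s', M.P s α s' = 1

open Classical in
/-- `supp(α)`: the support of the distribution that the action `α` has in the state `s`. -/
noncomputable def MDP.supp (M : MDP S Act AP) (s : S) (α : Act) : Finset S :=
  Finset.univ.filter fun s' => 0 < M.P s α s'

/-- Non-probabilistic memoryless schedulers: they choose an enabled action in every state. -/
def MDP.Scheduler [Fintype Act] (M : MDP S Act AP) : Type _ :=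
  {σ : S → Act // ∀ s, σ s ∈ M.enabled s}

/-- The Markov chain that a non-probabilistic memoryless scheduler induces. -/
noncomputable def MDP.induced [Fintype Act] (M : MDP S Act AP) (σ : M.Scheduler) : DTMC S AP where
  P s s' := M.P s (σ.1 s) s'
  nonneg s s' := (M.P_mem s (σ.1 s) s').1
  sum_P s := by
    have h := σ.2 s
    simpa [MDP.enabled] using h
  L := M.L

/-- The `n`-ary composition of Markov chains: the components move independently, and the
proposition `(a, i)` (written `a_i`) holds in `(s_1, …, s_n)` iff `a` holds in `s_i`. -/
noncomputable def DTMC.compose {n : ℕ} (C : Fin n → DTMC S AP) :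
    DTMC (Fin n → S) (AP × Fin n) where
  P s s' := ∏ i, (C i).P (s i) (s' i)
  nonneg s s' := Finset.prod_nonneg fun i _ => (C i).nonneg _ _
  sum_P s := by
    classical
    rw [← Fintype.prod_sum (fun i t => (C i).P (s i) t)]
    exact Finset.prod_eq_one fun i _ => (C i).sum_P (s i)
  L s := {x | x.1 ∈ (C x.2).L (s x.2)}

/-- The `n`-ary self-composition of `M` under the scheduler `σ`. -/
noncomputable def MDP.selfComp [Fintype Act] (M : MDP S Act AP) (σ : M.Scheduler) (n : ℕ) :
    DTMC (Fin n → S) (AP × Fin n) :=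
  DTMC.compose fun _ => M.induced σ

/-- The distribution of the successor of `t`. -/
noncomputable def DTMC.succPMF (C : DTMC T AP) (t : T) : PMF T :=
  PMF.ofFintype (fun t' => ENNReal.ofReal (C.P t t')) (by
    rw [← ENNReal.ofReal_sum_of_nonneg fun t' _ => C.nonneg t t', C.sum_P, ENNReal.ofReal_one])

/-- The one-step transition kernel. -/
noncomputable def DTMC.stepKernel [MeasurableSpace T] [DiscreteMeasurableSpace T]
    (C : DTMC T AP) : Kernel T T :=
  Kernel.ofFunOfCountable fun t => (C.succPMF t).toMeasure

instance DTMC.isMarkovKernel_stepKernel [MeasurableSpace T] [DiscreteMeasurableSpace T]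
    (C : DTMC T AP) : IsMarkovKernel C.stepKernel :=
  ⟨fun t => inferInstanceAs (IsProbabilityMeasure (C.succPMF t).toMeasure)⟩

/-- The kernel that continues a finite path `t_0 … t_m` by a successor of `t_m`. -/
noncomputable def DTMC.histKernel [MeasurableSpace T] [DiscreteMeasurableSpace T]
    (C : DTMC T AP) (m : ℕ) : Kernel ((_ : Finset.Iic m) → T) T :=
  C.stepKernel.comap (fun h => h ⟨m, Finset.mem_Iic.2 le_rfl⟩) (measurable_pi_apply _)

instance DTMC.isMarkovKernel_histKernel [MeasurableSpace T] [DiscreteMeasurableSpace T]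
    (C : DTMC T AP) (m : ℕ) : IsMarkovKernel (C.histKernel m) := by
  unfold DTMC.histKernel; infer_instance

/-- The probability measure on the infinite paths that start in `t` (Ionescu-Tulcea). -/
noncomputable def DTMC.pathMeasure [MeasurableSpace T] [DiscreteMeasurableSpace T]
    (C : DTMC T AP) (t : T) : Measure (ℕ → T) :=
  Kernel.traj (X := fun _ => T) C.histKernel 0 (fun _ => t)

/-- The probability of a set of infinite paths that start in `t`; the finite state set carries the
discrete σ-algebra and the set of paths the product σ-algebra. -/
noncomputable def DTMC.prob (C : DTMC T AP) (t : T) (A : Set (ℕ → T)) : ℝ :=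
  letI : MeasurableSpace T := ⊤
  haveI : DiscreteMeasurableSpace T := ⟨fun _ => trivial⟩
  (C.pathMeasure t).real A

end Models

/-! ### HyperPCTL with a single scheduler quantifier -/

universe u

mutual

/-- Quantifier-free HyperPCTL formulas over the state variables `ŝ_1, …, ŝ_n`. -/
inductive Form (AP : Type u) (n : ℕ)
  | tru : Form AP n
  | atom (a : AP) (i : Fin n) : Form AP n
  | and (φ₁ φ₂ : Form AP n) : Form AP n
  | neg (φ : Form AP n) : Form AP n
  | lt (e₁ e₂ : Expr AP n) : Form AP n

/-- Probability expressions. -/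
inductive Expr (AP : Type u) (n : ℕ)
  | prob (ψ : PathForm AP n) : Expr AP n
  | const (c : ℝ) : Expr AP n
  | add (e₁ e₂ : Expr AP n) : Expr AP n
  | sub (e₁ e₂ : Expr AP n) : Expr AP n
  | mul (e₁ e₂ : Expr AP n) : Expr AP n

/-- Path formulas: next, unbounded until, and until with the time bounds `[k₁, k₂]`. -/
inductive PathForm (AP : Type u) (n : ℕ)
  | next (φ : Form AP n) : PathForm AP n
  | unt (φ₁ φ₂ : Form AP n) : PathForm AP n
  | bunt (φ₁ φ₂ : Form AP n) (k₁ k₂ : ℕ) (hk : k₁ ≤ k₂) : PathForm AP n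

end

/-- Quantifiers. -/
inductive Quant
  | ex
  | all

/-- The dual quantifier. -/
def Quant.dual : Quant → Quant
  | .ex => .all
  | .all => .ex

/-- The formula `Q σ̂. Q_1 ŝ_1(σ̂). … Q_n ŝ_n(σ̂). φ`. -/
structure Formula (AP : Type*) (n : ℕ) where
  schedQ : Quant
  stateQ : Fin n → Quant
  body : Form AP n

section Semantics

variable {S Act AP T : Type*} {n : ℕ} [Fintype T]

mutual

/-- Satisfaction of a quantifier-free formula in a state of (a chain that plays the role of) the
`n`-ary self-composition. -/
noncomputable def Form.Sat (C : DTMC T (AP × Fin n)) : Form AP n → T → Prop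
  | .tru, _ => True
  | .atom a i, t => (a, i) ∈ C.L t
  | .and φ₁ φ₂, t => φ₁.Sat C t ∧ φ₂.Sat C t
  | .neg φ, t => ¬ φ.Sat C t
  | .lt e₁ e₂, t => e₁.val C t < e₂.val C t

/-- The value of a probability expression in a state. -/
noncomputable def Expr.val (C : DTMC T (AP × Fin n)) : Expr AP n → T → ℝ
  | .prob ψ, t => C.prob t {π | ψ.Sat C π}
  | .const c, _ => c
  | .add e₁ e₂, t => e₁.val C t + e₂.val C t
  | .sub e₁ e₂, t => e₁.val C t - e₂.val C t
  | .mul e₁ e₂, t => e₁.val C t * e₂.val C t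

/-- Satisfaction of a path formula on an infinite path. -/
noncomputable def PathForm.Sat (C : DTMC T (AP × Fin n)) : PathForm AP n → (ℕ → T) → Prop
  | .next φ, π => φ.Sat C (π 1)
  | .unt φ₁ φ₂, π => ∃ j, φ₂.Sat C (π j) ∧ ∀ i < j, φ₁.Sat C (π i)
  | .bunt φ₁ φ₂ k₁ k₂ _, π =>
      ∃ j, k₁ ≤ j ∧ j ≤ k₂ ∧ φ₂.Sat C (π j) ∧ ∀ i < j, φ₁.Sat C (π i)

end

/-- Meaning of the state quantifier prefix `Q_1 s_1. … Q_n s_n.` in front of the predicate `p`. -/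
def StatePrefix {S : Type*} : {n : ℕ} → (Fin n → Quant) → ((Fin n → S) → Prop) → Prop
  | 0, _, p => p Fin.elim0
  | _ + 1, Q, p =>
      match Q 0 with
      | .ex => ∃ s : S, StatePrefix (fun i => Q i.succ) fun v => p (Fin.cons s v)
      | .all => ∀ s : S, StatePrefix (fun i => Q i.succ) fun v => p (Fin.cons s v)

/-- `M ⊨ Φ`, where the scheduler quantifier ranges over non-probabilistic memoryless schedulers. -/
def MDP.Satisfies [Fintype S] [Fintype Act] (M : MDP S Act AP) (Φ : Formula AP n) : Prop :=
  match Φ.schedQ with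
  | .ex => ∃ σ : M.Scheduler, StatePrefix Φ.stateQ fun s => Φ.body.Sat (M.selfComp σ n) s
  | .all => ∀ σ : M.Scheduler, StatePrefix Φ.stateQ fun s => Φ.body.Sat (M.selfComp σ n) s

end Semantics

/-! ### The SMT language -/

/-- Real-valued SMT terms over the variables `pr_{s,e}` and `toInt_{s,φ}`. -/
inductive Term (S AP : Type*) (n : ℕ)
  | const (c : ℝ) : Term S AP n
  | pr (s : Fin n → S) (e : Expr AP n) : Term S AP n
  | toInt (s : Fin n → S) (φ : Form AP n) : Term S AP n
  | add (t₁ t₂ : Term S AP n) : Term S AP n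
  | sub (t₁ t₂ : Term S AP n) : Term S AP n
  | mul (t₁ t₂ : Term S AP n) : Term S AP n

/-- Quantifier-free SMT formulas over the scheduler variables `σ_s`, the propositions
`holds_{s,φ}`, the numeric variables and the distance variables `d_{s,φ}`. -/
inductive SMT (S Act AP : Type*) (n : ℕ)
  | tru : SMT S Act AP n
  | fls : SMT S Act AP n
  /-- `σ_s = α` -/
  | schedEq (s : S) (α : Act) : SMT S Act AP n
  /-- `holds_{s,φ}` -/
  | holds (s : Fin n → S) (φ : Form AP n) : SMT S Act AP n
  /-- `d_{s,φ} > d_{s',φ}` -/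
  | distGt (s s' : Fin n → S) (φ : Form AP n) : SMT S Act AP n
  | eq (t₁ t₂ : Term S AP n) : SMT S Act AP n
  | lt (t₁ t₂ : Term S AP n) : SMT S Act AP n
  | ge (t₁ t₂ : Term S AP n) : SMT S Act AP n
  | not (F : SMT S Act AP n) : SMT S Act AP n
  | and (F G : SMT S Act AP n) : SMT S Act AP n
  | or (F G : SMT S Act AP n) : SMT S Act AP n
  | xor (F G : SMT S Act AP n) : SMT S Act AP n
  | imp (F G : SMT S Act AP n) : SMT S Act AP n

section SMTSemantics

variable {S Act AP : Type*} {n : ℕ}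

/-- Assignments of values to the SMT variables. The variables `toInt` range over `{0,1}`, the
variables for the value of an expression `ℙ(ψ)` over `[0,1]`, the variables for the values of other
(arithmetic) expressions over `ℝ`, and the distance variables over the ordered set `D`. -/
structure Assignment (S Act AP : Type*) (n : ℕ) (D : Type*) where
  sched : S → Act
  holds : (Fin n → S) → Form AP n → Prop
  pr : (Fin n → S) → Expr AP n → ℝ
  pr_mem : ∀ s ψ, pr s (.prob ψ) ∈ Set.Icc (0 : ℝ) 1
  toInt : (Fin n → S) → Form AP n → ℝ
  toInt_mem : ∀ s φ, toInt s φ = 0 ∨ toInt s φ = 1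
  dist : (Fin n → S) → Form AP n → D

/-- Value of a term under an assignment. -/
def Term.eval {D : Type*} (ν : Assignment S Act AP n D) : Term S AP n → ℝ
  | .const c => c
  | .pr s e => ν.pr s e
  | .toInt s φ => ν.toInt s φ
  | .add t₁ t₂ => t₁.eval ν + t₂.eval ν
  | .sub t₁ t₂ => t₁.eval ν - t₂.eval ν
  | .mul t₁ t₂ => t₁.eval ν * t₂.eval ν

/-- Truth of an SMT formula under an assignment. -/
def SMT.Holds {D : Type*} [LinearOrder D] (ν : Assignment S Act AP n D) : SMT S Act AP n → Prop
  | .tru => True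
  | .fls => False
  | .schedEq s α => ν.sched s = α
  | .holds s φ => ν.holds s φ
  | .distGt s s' φ => ν.dist s φ > ν.dist s' φ
  | .eq t₁ t₂ => t₁.eval ν = t₂.eval ν
  | .lt t₁ t₂ => t₁.eval ν < t₂.eval ν
  | .ge t₁ t₂ => t₁.eval ν ≥ t₂.eval ν
  | .not F => ¬ F.Holds ν
  | .and F G => F.Holds ν ∧ G.Holds ν
  | .or F G => F.Holds ν ∨ G.Holds ν
  | .xor F G => Xor (F.Holds ν) (G.Holds ν)
  | .imp F G => F.Holds ν → G.Holds ν

/-- Satisfiability, with distance variables that range over `D`. -/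
def SMT.Satisfiable (D : Type*) [LinearOrder D] (F : SMT S Act AP n) : Prop :=
  ∃ ν : Assignment S Act AP n D, F.Holds ν

/-- Finite conjunction. -/
noncomputable def SMT.conj {ι : Type*} (I : Finset ι) (F : ι → SMT S Act AP n) : SMT S Act AP n :=
  (I.toList.map F).foldr .and .tru

/-- Finite disjunction. -/
noncomputable def SMT.disj {ι : Type*} (I : Finset ι) (F : ι → SMT S Act AP n) : SMT S Act AP n :=
  (I.toList.map F).foldr .or .fls

/-- Finite sum of terms. -/
noncomputable def Term.sum {ι : Type*} (I : Finset ι) (t : ι → Term S AP n) : Term S AP n :=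
  (I.toList.map t).foldr .add (.const 0)

end SMTSemantics

/-! ### The encoding -/

section Encoding

variable {S Act AP : Type*} [Fintype S] [Fintype Act] {n : ℕ}

/-- All composed states `s ∈ S^n`. -/
noncomputable def states (S : Type*) [Fintype S] (n : ℕ) : Finset (Fin n → S) := Finset.univ

open Classical in
/-- All composed states with the property `p`. -/
noncomputable def statesWith {S : Type*} [Fintype S] {n : ℕ} (p : (Fin n → S) → Prop) :
    Finset (Fin n → S) := Finset.univ.filter p

/-- `Act(s_1) × … × Act(s_n)`. -/
noncomputable def MDP.enabledVec (M : MDP S Act AP) (s : Fin n → S) : Finset (Fin n → Act) :=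
  Fintype.piFinset fun i => M.enabled (s i)

/-- `supp(α_1) × … × supp(α_n)`. -/
noncomputable def MDP.suppVec (M : MDP S Act AP) (s : Fin n → S) (α : Fin n → Act) :
    Finset (Fin n → S) :=
  Fintype.piFinset fun i => M.supp (s i) (α i)

/-- `⋀_i σ_{s_i} = α_i`. -/
noncomputable def chosen (s : Fin n → S) (α : Fin n → Act) : SMT S Act AP n :=
  SMT.conj Finset.univ fun i => .schedEq (s i) (α i)

/-- `∑_{s' ∈ supp(α_1) × … × supp(α_n)} (∏_i P(s_i, α_i, s'_i)) · x_{s'}`. -/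
noncomputable def succSum (M : MDP S Act AP) (s : Fin n → S) (α : Fin n → Act)
    (x : (Fin n → S) → Term S AP n) : Term S AP n :=
  Term.sum (M.suppVec s α) fun s' => .mul (.const (∏ i, M.P (s i) (α i) (s' i))) (x s')

/-- Unbounded until; `base` is the encoding of the two operands. -/
noncomputable def semanticsUnboundedUntil (M : MDP S Act AP) (base : SMT S Act AP n)
    (φ₁ φ₂ : Form AP n) : SMT S Act AP n :=
  let e : Expr AP n := .prob (.unt φ₁ φ₂)
  .and base <|
    .conj (states S n) fun s =>
      .and
        (.and (.imp (.holds s φ₂) (.eq (.pr s e) (.const 1)))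
          (.imp (.and (.not (.holds s φ₁)) (.not (.holds s φ₂))) (.eq (.pr s e) (.const 0))))
        (.conj (M.enabledVec s) fun α =>
          .imp (.and (.holds s φ₁) (.and (.not (.holds s φ₂)) (chosen s α)))
            (.and (.eq (.pr s e) (succSum M s α fun s' => .pr s' e))
              (.imp (.lt (.const 0) (.pr s e))
                (.disj (M.suppVec s α) fun s' => .or (.holds s' φ₂) (.distGt s s' φ₂)))))

/-- Bounded until; `base` is the encoding of the two operands. -/
noncomputable def semanticsBoundedUntil (M : MDP S Act AP) (base : SMT S Act AP n)
    (φ₁ φ₂ : Form AP n) : (k₁ k₂ : ℕ) → k₁ ≤ k₂ → SMT S Act AP n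
  | k₁, 0, hk =>
      let e : Expr AP n := .prob (.bunt φ₁ φ₂ k₁ 0 hk)
      .and base <|
        .conj (states S n) fun s =>
          .and (.imp (.holds s φ₂) (.eq (.pr s e) (.const 1)))
            (.imp (.not (.holds s φ₂)) (.eq (.pr s e) (.const 0)))
  | 0, k₂ + 1, hk =>
      let e : Expr AP n := .prob (.bunt φ₁ φ₂ 0 (k₂ + 1) hk)
      let e' : Expr AP n := .prob (.bunt φ₁ φ₂ 0 k₂ (Nat.zero_le k₂))
      .and (semanticsBoundedUntil M base φ₁ φ₂ 0 k₂ (Nat.zero_le k₂)) <|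
        .conj (states S n) fun s =>
          .and
            (.and (.imp (.holds s φ₂) (.eq (.pr s e) (.const 1)))
              (.imp (.and (.not (.holds s φ₁)) (.not (.holds s φ₂))) (.eq (.pr s e) (.const 0))))
            (.conj (M.enabledVec s) fun α =>
              .imp (.and (.holds s φ₁) (.and (.not (.holds s φ₂)) (chosen s α)))
                (.eq (.pr s e) (succSum M s α fun s' => .pr s' e')))
  | k₁ + 1, k₂ + 1, hk =>
      let e : Expr AP n := .prob (.bunt φ₁ φ₂ (k₁ + 1) (k₂ + 1) hk)
      let e' : Expr AP n := .prob (.bunt φ₁ φ₂ k₁ k₂ (Nat.le_of_succ_le_succ hk))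
      .and (semanticsBoundedUntil M base φ₁ φ₂ k₁ k₂ (Nat.le_of_succ_le_succ hk)) <|
        .conj (states S n) fun s =>
          .and (.imp (.not (.holds s φ₁)) (.eq (.pr s e) (.const 0)))
            (.conj (M.enabledVec s) fun α =>
              .imp (.and (.holds s φ₁) (chosen s α))
                (.eq (.pr s e) (succSum M s α fun s' => .pr s' e')))

mutual

/-- The encoding of the meaning of a quantifier-free formula. -/
noncomputable def Form.semantics (M : MDP S Act AP) : Form AP n → SMT S Act AP n
  | .tru => .conj (states S n) fun s => .holds s .tru
  | .atom a i =>
      .and (.conj (statesWith fun s : Fin n → S => a ∈ M.L (s i)) fun s => .holds s (.atom a i))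
        (.conj (statesWith fun s : Fin n → S => a ∉ M.L (s i)) fun s => .not (.holds s (.atom a i)))
  | .and φ₁ φ₂ =>
      .and (.and (φ₁.semantics M) (φ₂.semantics M)) <|
        .conj (states S n) fun s =>
          .or (.and (.holds s (.and φ₁ φ₂)) (.and (.holds s φ₁) (.holds s φ₂)))
            (.and (.not (.holds s (.and φ₁ φ₂))) (.or (.not (.holds s φ₁)) (.not (.holds s φ₂))))
  | .neg φ =>
      .and (φ.semantics M) <| .conj (states S n) fun s => .xor (.holds s (.neg φ)) (.holds s φ)
  | .lt e₁ e₂ =>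
      .and (.and (e₁.semantics M) (e₂.semantics M)) <|
        .conj (states S n) fun s =>
          .or (.and (.holds s (.lt e₁ e₂)) (.lt (.pr s e₁) (.pr s e₂)))
            (.and (.not (.holds s (.lt e₁ e₂))) (.ge (.pr s e₁) (.pr s e₂)))

/-- The encoding of the meaning of a probability expression. -/
noncomputable def Expr.semantics (M : MDP S Act AP) : Expr AP n → SMT S Act AP n
  | .prob ψ => ψ.semantics M
  | .const c => .conj (states S n) fun s => .eq (.pr s (.const c)) (.const c)
  | .add e₁ e₂ =>
      .and (.and (e₁.semantics M) (e₂.semantics M)) <|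
        .conj (states S n) fun s => .eq (.pr s (.add e₁ e₂)) (.add (.pr s e₁) (.pr s e₂))
  | .sub e₁ e₂ =>
      .and (.and (e₁.semantics M) (e₂.semantics M)) <|
        .conj (states S n) fun s => .eq (.pr s (.sub e₁ e₂)) (.sub (.pr s e₁) (.pr s e₂))
  | .mul e₁ e₂ =>
      .and (.and (e₁.semantics M) (e₂.semantics M)) <|
        .conj (states S n) fun s => .eq (.pr s (.mul e₁ e₂)) (.mul (.pr s e₁) (.pr s e₂))

/-- The encoding of the meaning of the expression `ℙ(ψ)` for a path formula `ψ`. -/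
noncomputable def PathForm.semantics (M : MDP S Act AP) : PathForm AP n → SMT S Act AP n
  | .next φ =>
      .and
        (.and (φ.semantics M) <|
          .conj (states S n) fun s =>
            .or (.and (.eq (.toInt s φ) (.const 1)) (.holds s φ))
              (.and (.eq (.toInt s φ) (.const 0)) (.not (.holds s φ)))) <|
        .conj (states S n) fun s => .conj (M.enabledVec s) fun α =>
          .imp (chosen s α)
            (.eq (.pr s (.prob (.next φ))) (succSum M s α fun s' => .toInt s' φ))
  | .unt φ₁ φ₂ => semanticsUnboundedUntil M (.and (φ₁.semantics M) (φ₂.semantics M)) φ₁ φ₂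
  | .bunt φ₁ φ₂ k₁ k₂ hk =>
      semanticsBoundedUntil M (.and (φ₁.semantics M) (φ₂.semantics M)) φ₁ φ₂ k₁ k₂ hk

end

/-- The encoding of the state quantifiers: `B_1 … B_n F_{(s_1, …, s_n)}`, where `B_i` is a
conjunction or a disjunction over `s_i ∈ S`. -/
noncomputable def quantEnc {m : ℕ} : {n : ℕ} → (Fin n → Quant) → ((Fin n → S) → SMT S Act AP m) →
    SMT S Act AP m
  | 0, _, F => F Fin.elim0
  | _ + 1, Q, F =>
      match Q 0 with
      | .ex => .disj Finset.univ fun s : S => quantEnc (fun i => Q i.succ) fun v => F (Fin.cons s v)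
      | .all => .conj Finset.univ fun s : S => quantEnc (fun i => Q i.succ) fun v => F (Fin.cons s v)

/-- The encoding of the truth of `∃ σ̂. Q_1 ŝ_1(σ̂). … Q_n ŝ_n(σ̂). φ`. -/
noncomputable def truthEnc (Q : Fin n → Quant) (φ : Form AP n) : SMT S Act AP n :=
  quantEnc Q fun s => .holds s φ

/-- `⋀_{s ∈ S} ⋁_{α ∈ Act(s)} σ_s = α`. -/
noncomputable def schedulerChoice (M : MDP S Act AP) : SMT S Act AP n :=
  .conj Finset.univ fun s => .disj (M.enabled s) fun α => .schedEq s α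

/-- The SMT formula that the main algorithm builds and checks. -/
noncomputable def encoding (M : MDP S Act AP) (Φ : Formula AP n) : SMT S Act AP n :=
  match Φ.schedQ with
  | .ex => .and (.and (schedulerChoice M) (Φ.body.semantics M)) (truthEnc Φ.stateQ Φ.body)
  | .all =>
      .and (.and (schedulerChoice M) (Form.semantics M (.neg Φ.body)))
        (truthEnc (fun i => (Φ.stateQ i).dual) (.neg Φ.body))

open Classical in
/-- The answer of the main algorithm. -/
noncomputable def mainAlgorithm (D : Type*) [LinearOrder D] (M : MDP S Act AP)
    (Φ : Formula AP n) : Bool :=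
  match Φ.schedQ with
  | .ex => if (encoding M Φ).Satisfiable D then true else false
  | .all => if (encoding M Φ).Satisfiable D then false else true

end Encoding

/-! ### Unbounded until probabilities as a fixed point -/

section Until

variable {AP T : Type*} {n : ℕ}

mutual

/-- The pairs `(φ₁, φ₂)` such that `ℙ(φ₁ U φ₂)` occurs in the formula. -/
def Form.untils : Form AP n → Set (Form AP n × Form AP n)
  | .tru => ∅
  | .atom _ _ => ∅
  | .and φ₁ φ₂ => φ₁.untils ∪ φ₂.untils
  | .neg φ => φ.untils
  | .lt e₁ e₂ => e₁.untils ∪ e₂.untils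

/-- The pairs `(φ₁, φ₂)` such that `ℙ(φ₁ U φ₂)` occurs in the expression. -/
def Expr.untils : Expr AP n → Set (Form AP n × Form AP n)
  | .prob ψ => ψ.untils
  | .const _ => ∅
  | .add e₁ e₂ => e₁.untils ∪ e₂.untils
  | .sub e₁ e₂ => e₁.untils ∪ e₂.untils
  | .mul e₁ e₂ => e₁.untils ∪ e₂.untils

/-- The pairs `(φ₁, φ₂)` such that `ℙ(φ₁ U φ₂)` occurs in `ℙ(ψ)`. -/
def PathForm.untils : PathForm AP n → Set (Form AP n × Form AP n)
  | .next φ => φ.untils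
  | .unt φ₁ φ₂ => insert (φ₁, φ₂) (φ₁.untils ∪ φ₂.untils)
  | .bunt φ₁ φ₂ _ _ _ => φ₁.untils ∪ φ₂.untils

end

open Classical in
/-- The operator of the equation system for the probabilities of `A U B` in a Markov chain. -/
noncomputable def untilOp [Fintype T] (C : DTMC T AP) (A B : T → Prop) (p : T → ℝ) : T → ℝ :=
  fun t => if B t then 1 else if A t then ∑ t', C.P t t' * p t' else 0

end Until

end HyperPCTL

namespace HyperPCTL

open MeasureTheory ProbabilityTheory
open scoped BigOperators

section PathMeasure

variable {T AP : Type*}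

/-- The paths that agree with `x` up to time `m`. -/
def prefixCylinder (m : ℕ) (x : ℕ → T) : Set (ℕ → T) := {π | ∀ i ≤ m, π i = x i}

/-- Extension of a path by a new first state. -/
def consPath (t : T) (π : ℕ → T) : ℕ → T
  | 0 => t
  | k + 1 => π k

lemma consPath_mem_prefixCylinder_succ {t : T} {m : ℕ} {x π : ℕ → T} :
    consPath t π ∈ prefixCylinder (m + 1) x ↔
      t = x 0 ∧ π ∈ prefixCylinder m fun i => x (i + 1) := by
  constructor
  · intro h
    exact ⟨h 0 (Nat.zero_le _), fun i hi => h (i + 1) (by omega)⟩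
  · rintro ⟨h₀, h⟩ (_ | i) hi
    · exact h₀
    · exact h i (by omega)

lemma prefixCylinder_eq_preimage (m : ℕ) (x : ℕ → T) :
    prefixCylinder m x =
      Preorder.frestrictLe (π := fun _ => T) m ⁻¹'
        {Preorder.frestrictLe (π := fun _ => T) m x} := by
  ext π
  simp [prefixCylinder, funext_iff]

variable [MeasurableSpace T]

lemma measurable_consPath (t : T) : Measurable (consPath t) := by
  rw [measurable_pi_iff]
  rintro (_ | k)
  · exact measurable_const
  · exact measurable_pi_apply k

variable [DiscreteMeasurableSpace T]

lemma measurableSet_prefixCylinder (m : ℕ) (x : ℕ → T) :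
    MeasurableSet (prefixCylinder m x) := by
  have : prefixCylinder m x = ⋂ i, ⋂ (_ : i ≤ m), (fun π : ℕ → T => π i) ⁻¹' {x i} := by
    ext π; simp [prefixCylinder]
  rw [this]
  exact MeasurableSet.iInter fun i => MeasurableSet.iInter fun _ =>
    measurable_pi_apply i (.of_discrete)

variable [Fintype T]

/-- A finite measure on paths is determined by the measures of the prefix cylinders. -/
lemma measure_ext_of_prefixCylinder [Nonempty T] {μ ν : Measure (ℕ → T)} [IsFiniteMeasure μ]
    (h : ∀ m x, μ (prefixCylinder m x) = ν (prefixCylinder m x)) : μ = ν := by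
  have hm : ∀ m, ν.map (Preorder.frestrictLe (π := fun _ => T) m) =
      μ.map (Preorder.frestrictLe (π := fun _ => T) m) := by
    intro m
    refine Measure.ext_of_singleton fun y => ?_
    rw [Measure.map_apply (Preorder.measurable_frestrictLe m) (measurableSet_singleton y),
      Measure.map_apply (Preorder.measurable_frestrictLe m) (measurableSet_singleton y)]
    let x : ℕ → T := fun i =>
      if hi : i ≤ m then y ⟨i, Finset.mem_Iic.2 hi⟩ else Classical.arbitrary T
    have hx : Preorder.frestrictLe (π := fun _ => T) m x = y := by
      ext ⟨i, hi⟩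
      have : i ≤ m := Finset.mem_Iic.1 hi
      simp [x, this]
    rw [← hx, ← prefixCylinder_eq_preimage]
    exact (h m x).symm
  have hproj : IsProjectiveMeasureFamily (α := fun _ : ℕ => T)
      (fun I : Finset ℕ => μ.map I.restrict) := by
    intro I J hJI
    change μ.map J.restrict = (μ.map I.restrict).map (Finset.restrict₂ (π := fun _ => T) hJI)
    rw [Measure.map_map (by fun_prop) (by fun_prop)]
    rfl
  have hμ : IsProjectiveLimit μ (fun I : Finset ℕ => μ.map I.restrict) := fun _ => rfl
  have hν : IsProjectiveLimit ν (fun I : Finset ℕ => μ.map I.restrict) :=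
    (isProjectiveLimit_nat_iff hproj ν).2 hm
  exact hμ.unique hν

variable (C : DTMC T AP)

instance DTMC.isProbabilityMeasure_pathMeasure (t : T) :
    IsProbabilityMeasure (C.pathMeasure t) := by
  unfold DTMC.pathMeasure; infer_instance

lemma DTMC.stepKernel_singleton (t t' : T) :
    C.stepKernel t {t'} = ENNReal.ofReal (C.P t t') := by
  change (C.succPMF t).toMeasure {t'} = _
  rw [PMF.toMeasure_apply_singleton _ _ (measurableSet_singleton t')]
  rfl

lemma DTMC.pathMeasure_zero (t : T) (A : Set T) [Decidable (t ∈ A)] :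
    C.pathMeasure t {π | π 0 ∈ A} = if t ∈ A then 1 else 0 := by
  have h := Kernel.traj_map_frestrictLe_apply (X := fun _ => T) (κ := C.histKernel) 0 0 (fun _ => t)
  have hA : {π : ℕ → T | π 0 ∈ A} = Preorder.frestrictLe (π := fun _ => T) 0 ⁻¹'
      {h | h ⟨0, Finset.mem_Iic.2 le_rfl⟩ ∈ A} := by
    ext π; simp
  have hm : MeasurableSet {h : (_ : Finset.Iic 0) → T | h ⟨0, Finset.mem_Iic.2 le_rfl⟩ ∈ A} :=
    .of_discrete
  rw [hA, ← Measure.map_apply (Preorder.measurable_frestrictLe 0) hm, DTMC.pathMeasure, h,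
    Kernel.partialTraj_self, Kernel.id_apply, Measure.dirac_apply' _ hm]
  simp [Set.indicator_apply]

lemma DTMC.pathMeasure_prefixCylinder_zero [DecidableEq T] (t : T) (x : ℕ → T) :
    C.pathMeasure t (prefixCylinder 0 x) = if t = x 0 then 1 else 0 := by
  have : prefixCylinder 0 x = {π | π 0 ∈ ({x 0} : Set T)} := by
    ext π; simp [prefixCylinder]
  rw [this, C.pathMeasure_zero]
  simp

lemma DTMC.pathMeasure_prefixCylinder_succ (t : T) (m : ℕ) (x : ℕ → T) :
    C.pathMeasure t (prefixCylinder (m + 1) x) =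
      C.pathMeasure t (prefixCylinder m x) * ENNReal.ofReal (C.P (x m) (x (m + 1))) := by
  have h := Kernel.partialTraj_compProd_eq_map_traj (X := fun _ => T) (κ := C.histKernel)
    (Nat.zero_le m) (x₀ := fun _ => t)
  have hs : prefixCylinder (m + 1) x =
      (fun π : ℕ → T => (Preorder.frestrictLe (π := fun _ => T) m π, π (m + 1))) ⁻¹'
        ({Preorder.frestrictLe (π := fun _ => T) m x} ×ˢ {x (m + 1)}) := by
    ext π
    simp only [Set.mem_preimage, Set.mem_prod, Set.mem_singleton_iff]
    constructor
    · intro h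
      exact ⟨funext fun i => h i (Nat.le_succ_of_le (Finset.mem_Iic.1 i.2)), h _ le_rfl⟩
    · rintro ⟨h₁, h₂⟩ i hi
      rcases Nat.le_succ_iff.1 hi with hi | rfl
      · exact congrFun h₁ ⟨i, Finset.mem_Iic.2 hi⟩
      · exact h₂
  have hm : Measurable
      (fun π : ℕ → T => (Preorder.frestrictLe (π := fun _ => T) m π, π (m + 1))) := by fun_prop
  rw [hs, DTMC.pathMeasure, ← Measure.map_apply hm
    ((measurableSet_singleton _).prod (measurableSet_singleton _)), ← h,
    Measure.compProd_apply_prod (measurableSet_singleton _) (measurableSet_singleton _),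
    lintegral_singleton, prefixCylinder_eq_preimage,
    ← Measure.map_apply (Preorder.measurable_frestrictLe m) (measurableSet_singleton _),
    Kernel.traj_map_frestrictLe_apply, mul_comm]
  congr 1
  rw [DTMC.histKernel, Kernel.comap_apply, DTMC.stepKernel_singleton]
  simp

/-- The Markov property: after the first step, the path is a path from the successor. -/
lemma DTMC.pathMeasure_eq_sum_map (t : T) :
    C.pathMeasure t =
      ∑ t', ENNReal.ofReal (C.P t t') • (C.pathMeasure t').map (consPath t) := by
  classical
  have : Nonempty T := ⟨t⟩
  refine measure_ext_of_prefixCylinder fun m x => ?_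
  have hs : ∀ m, (∑ t', ENNReal.ofReal (C.P t t') • (C.pathMeasure t').map (consPath t))
      (prefixCylinder (m + 1) x) = ∑ t', ENNReal.ofReal (C.P t t') *
        (if t = x 0 then C.pathMeasure t' (prefixCylinder m fun i => x (i + 1)) else 0) := by
    intro m
    simp only [Measure.coe_finsetSum, Finset.sum_apply, Measure.smul_apply, smul_eq_mul]
    refine Finset.sum_congr rfl fun t' _ => ?_
    rw [Measure.map_apply (measurable_consPath t) (measurableSet_prefixCylinder _ _)]
    congr 1
    split_ifs with h
    · congr 1
      ext π
      simp [consPath_mem_prefixCylinder_succ, h]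
    · convert measure_empty (μ := C.pathMeasure t')
      ext π
      simp [consPath_mem_prefixCylinder_succ, h]
  induction m with
  | zero =>
    rw [C.pathMeasure_prefixCylinder_zero]
    simp only [Measure.coe_finsetSum, Finset.sum_apply, Measure.smul_apply, smul_eq_mul]
    have : ∀ t', (C.pathMeasure t').map (consPath t) (prefixCylinder 0 x) =
        if t = x 0 then 1 else 0 := by
      intro t'
      rw [Measure.map_apply (measurable_consPath t) (measurableSet_prefixCylinder _ _)]
      have hp : consPath t ⁻¹' prefixCylinder 0 x = if t = x 0 then Set.univ else ∅ := by
        ext π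
        split_ifs with h <;> simp [prefixCylinder, consPath, h]
      rw [hp]
      split_ifs <;> simp
    simp only [this, ← Finset.sum_mul]
    rw [← ENNReal.ofReal_sum_of_nonneg fun t' _ => C.nonneg t t', C.sum_P]
    simp
  | succ m ih =>
    rw [C.pathMeasure_prefixCylinder_succ, hs]
    cases m with
    | zero =>
      rw [C.pathMeasure_prefixCylinder_zero]
      simp only [C.pathMeasure_prefixCylinder_zero]
      split_ifs with h
      · simp [h]
      · simp
    | succ m =>
      rw [ih, hs, Finset.sum_mul]
      refine Finset.sum_congr rfl fun t' _ => ?_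
      rw [C.pathMeasure_prefixCylinder_succ]
      split_ifs <;> simp [mul_assoc]

end PathMeasure

section PathSets

variable {T AP : Type*}

/-- The paths that satisfy `A U B`. -/
def untilPaths (A B : T → Prop) : Set (ℕ → T) := {π | ∃ j, B (π j) ∧ ∀ i < j, A (π i)}

/-- The paths that satisfy `A U^[k₁, k₂] B`. -/
def boundedUntilPaths (A B : T → Prop) (k₁ k₂ : ℕ) : Set (ℕ → T) :=
  {π | ∃ j, k₁ ≤ j ∧ j ≤ k₂ ∧ B (π j) ∧ ∀ i < j, A (π i)}

lemma consPath_mem_untilPaths {A B : T → Prop} {t : T} {π : ℕ → T} :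
    consPath t π ∈ untilPaths A B ↔ B t ∨ A t ∧ π ∈ untilPaths A B := by
  constructor
  · rintro ⟨_ | j, hB, hA⟩
    · exact .inl hB
    · exact .inr ⟨hA 0 (Nat.succ_pos j), j, hB, fun i hi => hA (i + 1) (by omega)⟩
  · rintro (hB | ⟨hA, j, hB, hj⟩)
    · exact ⟨0, hB, fun i hi => absurd hi (Nat.not_lt_zero i)⟩
    · refine ⟨j + 1, hB, ?_⟩
      rintro (_ | i) hi
      · exact hA
      · exact hj i (by omega)

lemma consPath_mem_boundedUntilPaths_zero_succ {A B : T → Prop} {k : ℕ} {t : T} {π : ℕ → T} :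
    consPath t π ∈ boundedUntilPaths A B 0 (k + 1) ↔
      B t ∨ A t ∧ π ∈ boundedUntilPaths A B 0 k := by
  constructor
  · rintro ⟨_ | j, -, hk, hB, hA⟩
    · exact .inl hB
    · exact .inr ⟨hA 0 (Nat.succ_pos j), j, Nat.zero_le j, by omega, hB,
        fun i hi => hA (i + 1) (by omega)⟩
  · rintro (hB | ⟨hA, j, -, hk, hB, hj⟩)
    · exact ⟨0, le_rfl, Nat.zero_le _, hB, fun i hi => absurd hi (Nat.not_lt_zero i)⟩
    · refine ⟨j + 1, Nat.zero_le _, by omega, hB, ?_⟩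
      rintro (_ | i) hi
      · exact hA
      · exact hj i (by omega)

lemma consPath_mem_boundedUntilPaths_succ_succ {A B : T → Prop} {k₁ k₂ : ℕ} {t : T} {π : ℕ → T} :
    consPath t π ∈ boundedUntilPaths A B (k₁ + 1) (k₂ + 1) ↔
      A t ∧ π ∈ boundedUntilPaths A B k₁ k₂ := by
  constructor
  · rintro ⟨_ | j, h₁, h₂, hB, hA⟩
    · omega
    · exact ⟨hA 0 (Nat.succ_pos j), j, by omega, by omega, hB, fun i hi => hA (i + 1) (by omega)⟩
  · rintro ⟨hA, j, h₁, h₂, hB, hj⟩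
    refine ⟨j + 1, by omega, by omega, hB, ?_⟩
    rintro (_ | i) hi
    · exact hA
    · exact hj i (by omega)

lemma boundedUntilPaths_zero_zero (A B : T → Prop) :
    boundedUntilPaths A B 0 0 = {π | π 0 ∈ {t | B t}} := by
  ext π
  constructor
  · rintro ⟨j, -, hj, hB, -⟩
    obtain rfl := Nat.le_zero.1 hj
    exact hB
  · intro hB
    exact ⟨0, le_rfl, le_rfl, hB, fun i hi => absurd hi (Nat.not_lt_zero i)⟩

lemma untilPaths_eq_iUnion (A B : T → Prop) :
    untilPaths A B = ⋃ k, boundedUntilPaths A B 0 k := by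
  ext π
  simp only [Set.mem_iUnion]
  exact ⟨fun ⟨j, h⟩ => ⟨j, j, Nat.zero_le j, le_rfl, h⟩, fun ⟨_, j, _, _, h⟩ => ⟨j, h⟩⟩

lemma monotone_boundedUntilPaths (A B : T → Prop) : Monotone (boundedUntilPaths A B 0) :=
  fun _ _ hk _ ⟨j, h₀, hj, h⟩ => ⟨j, h₀, hj.trans hk, h⟩

variable [MeasurableSpace T] [DiscreteMeasurableSpace T]

lemma measurableSet_coord (A : T → Prop) (i : ℕ) : MeasurableSet {π : ℕ → T | A (π i)} :=
  measurable_pi_apply (X := fun _ => T) i (MeasurableSet.of_discrete (s := {t | A t}))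

lemma measurableSet_boundedUntilPaths (A B : T → Prop) (k₁ k₂ : ℕ) :
    MeasurableSet (boundedUntilPaths A B k₁ k₂) := by
  have : boundedUntilPaths A B k₁ k₂ = ⋃ j, ⋃ (_ : k₁ ≤ j), ⋃ (_ : j ≤ k₂),
      {π : ℕ → T | B (π j)} ∩ ⋂ i, ⋂ (_ : i < j), {π : ℕ → T | A (π i)} := by
    ext π
    simp only [boundedUntilPaths, Set.mem_ofPred_eq, Set.mem_iUnion, Set.mem_inter_iff,
      Set.mem_iInter, exists_prop]
  rw [this]
  exact .iUnion fun j => .iUnion fun _ => .iUnion fun _ => (measurableSet_coord B j).inter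
    (.iInter fun i => .iInter fun _ => measurableSet_coord A i)

lemma measurableSet_untilPaths (A B : T → Prop) : MeasurableSet (untilPaths A B) := by
  rw [untilPaths_eq_iUnion]
  exact .iUnion fun k => measurableSet_boundedUntilPaths A B 0 k

end PathSets

section Probabilities

variable {T AP : Type*} [Fintype T] (C : DTMC T AP)

lemma DTMC.prob_nonneg (t : T) (A : Set (ℕ → T)) : 0 ≤ C.prob t A := measureReal_nonneg

lemma DTMC.prob_le_one (t : T) (A : Set (ℕ → T)) : C.prob t A ≤ 1 := by
  let _ : MeasurableSpace T := ⊤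
  have : DiscreteMeasurableSpace T := ⟨fun _ => trivial⟩
  exact measureReal_le_one

lemma DTMC.prob_mono (t : T) {A B : Set (ℕ → T)} (h : A ⊆ B) : C.prob t A ≤ C.prob t B := by
  let _ : MeasurableSpace T := ⊤
  have : DiscreteMeasurableSpace T := ⟨fun _ => trivial⟩
  exact measureReal_mono h

lemma DTMC.prob_univ (t : T) : C.prob t Set.univ = 1 := by
  let _ : MeasurableSpace T := ⊤
  have : DiscreteMeasurableSpace T := ⟨fun _ => trivial⟩
  exact probReal_univ

lemma DTMC.prob_empty (t : T) : C.prob t ∅ = 0 := by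
  let _ : MeasurableSpace T := ⊤
  have : DiscreteMeasurableSpace T := ⟨fun _ => trivial⟩
  exact measureReal_empty

open Classical in
lemma DTMC.prob_zero (t : T) (A : Set T) :
    C.prob t {π | π 0 ∈ A} = if t ∈ A then 1 else 0 := by
  let _ : MeasurableSpace T := ⊤
  have : DiscreteMeasurableSpace T := ⟨fun _ => trivial⟩
  change (C.pathMeasure t {π | π 0 ∈ A}).toReal = _
  rw [C.pathMeasure_zero]
  split_ifs <;> simp

/-- First-step analysis of the probability of a measurable set of paths. -/
lemma DTMC.prob_eq_sum (t : T) {A : Set (ℕ → T)}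
    (hA : MeasurableSet[@MeasurableSpace.pi ℕ (fun _ => T) fun _ => ⊤] A) :
    C.prob t A = ∑ t', C.P t t' * C.prob t' {π | consPath t π ∈ A} := by
  let _ : MeasurableSpace T := ⊤
  have : DiscreteMeasurableSpace T := ⟨fun _ => trivial⟩
  change (C.pathMeasure t A).toReal = ∑ t', C.P t t' * (C.pathMeasure t' _).toReal
  rw [C.pathMeasure_eq_sum_map t]
  simp only [Measure.coe_finsetSum, Finset.sum_apply, Measure.smul_apply, smul_eq_mul]
  rw [ENNReal.toReal_sum fun t' _ => ENNReal.mul_ne_top ENNReal.ofReal_ne_top (measure_ne_top _ _)]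
  refine Finset.sum_congr rfl fun t' _ => ?_
  rw [ENNReal.toReal_mul, ENNReal.toReal_ofReal (C.nonneg t t'),
    Measure.map_apply (measurable_consPath t) hA]
  rfl

open Classical in
lemma DTMC.prob_next (t : T) (A : T → Prop) :
    C.prob t {π | A (π 1)} = ∑ t', C.P t t' * if A t' then 1 else 0 := by
  let _ : MeasurableSpace T := ⊤
  have : DiscreteMeasurableSpace T := ⟨fun _ => trivial⟩
  rw [C.prob_eq_sum t (measurableSet_coord A 1)]
  exact Finset.sum_congr rfl fun t' _ => congrArg _ (C.prob_zero t' {t | A t})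

open Classical in
/-- If `A` consists of all or no extensions of paths in `B`, depending on the first state, then its
probability follows by one step of the chain. -/
lemma DTMC.prob_eq_ite (t : T) {A B : Set (ℕ → T)} {b a : Prop}
    (hA : MeasurableSet[@MeasurableSpace.pi ℕ (fun _ => T) fun _ => ⊤] A)
    (h : ∀ π, consPath t π ∈ A ↔ b ∨ a ∧ π ∈ B) :
    C.prob t A = if b then 1 else if a then ∑ t', C.P t t' * C.prob t' B else 0 := by
  rw [C.prob_eq_sum t hA]
  simp only [h]
  split_ifs with hb ha
  · simp [hb, C.prob_univ, C.sum_P]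
  · simp [hb, ha]
  · simp [hb, ha, C.prob_empty]

lemma DTMC.untilOp_prob_untilPaths (A B : T → Prop) :
    untilOp C A B (fun t => C.prob t (untilPaths A B)) = fun t => C.prob t (untilPaths A B) := by
  let _ : MeasurableSpace T := ⊤
  have : DiscreteMeasurableSpace T := ⟨fun _ => trivial⟩
  funext t
  exact (C.prob_eq_ite t (measurableSet_untilPaths A B) fun _ => consPath_mem_untilPaths).symm

lemma DTMC.prob_boundedUntilPaths_zero_succ (A B : T → Prop) (k : ℕ) (t : T) :
    C.prob t (boundedUntilPaths A B 0 (k + 1)) =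
      untilOp C A B (fun t' => C.prob t' (boundedUntilPaths A B 0 k)) t := by
  let _ : MeasurableSpace T := ⊤
  have : DiscreteMeasurableSpace T := ⟨fun _ => trivial⟩
  exact C.prob_eq_ite t (measurableSet_boundedUntilPaths A B _ _)
    fun _ => consPath_mem_boundedUntilPaths_zero_succ

open Classical in
lemma DTMC.prob_boundedUntilPaths_succ_succ (A B : T → Prop) (k₁ k₂ : ℕ) (t : T) :
    C.prob t (boundedUntilPaths A B (k₁ + 1) (k₂ + 1)) =
      if A t then ∑ t', C.P t t' * C.prob t' (boundedUntilPaths A B k₁ k₂) else 0 := by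
  let _ : MeasurableSpace T := ⊤
  have : DiscreteMeasurableSpace T := ⟨fun _ => trivial⟩
  rw [C.prob_eq_ite (b := False) (a := A t) t (measurableSet_boundedUntilPaths A B _ _)
    (by simpa using fun π => consPath_mem_boundedUntilPaths_succ_succ), if_neg not_false]

open Classical in
lemma DTMC.prob_boundedUntilPaths_zero_zero (A B : T → Prop) (t : T) :
    C.prob t (boundedUntilPaths A B 0 0) = if B t then 1 else 0 := by
  rw [boundedUntilPaths_zero_zero]
  exact C.prob_zero t {t | B t}

lemma DTMC.tendsto_prob_boundedUntilPaths (A B : T → Prop) (t : T) :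
    Filter.Tendsto (fun k => C.prob t (boundedUntilPaths A B 0 k)) Filter.atTop
      (nhds (C.prob t (untilPaths A B))) := by
  let _ : MeasurableSpace T := ⊤
  have : DiscreteMeasurableSpace T := ⟨fun _ => trivial⟩
  rw [untilPaths_eq_iUnion]
  exact (ENNReal.tendsto_toReal (measure_ne_top _ _)).comp
    (tendsto_measure_iUnion_atTop (μ := C.pathMeasure t) (monotone_boundedUntilPaths A B))

lemma untilOp_mono (A B : T → Prop) {p q : T → ℝ} (h : ∀ t, p t ≤ q t) (t : T) :
    untilOp C A B p t ≤ untilOp C A B q t := by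
  unfold untilOp
  split_ifs
  · exact le_rfl
  · exact Finset.sum_le_sum fun t' _ => mul_le_mul_of_nonneg_left (h t') (C.nonneg t t')
  · exact le_rfl

/-- The until probabilities are below every nonnegative solution of the equation system. -/
lemma DTMC.prob_untilPaths_le (A B : T → Prop) {p : T → ℝ} (hp : ∀ t, 0 ≤ p t)
    (hfix : untilOp C A B p = p) (t : T) : C.prob t (untilPaths A B) ≤ p t := by
  refine le_of_tendsto' (C.tendsto_prob_boundedUntilPaths A B t) fun k => ?_
  induction k generalizing t with
  | zero =>
    rw [C.prob_boundedUntilPaths_zero_zero]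
    split_ifs with hB
    · rw [← hfix, untilOp, if_pos hB]
    · exact hp t
  | succ k ih =>
    rw [C.prob_boundedUntilPaths_zero_succ, ← congrFun hfix t]
    exact untilOp_mono C A B ih t

lemma DTMC.isLeast_prob_untilPaths (A B : T → Prop) :
    IsLeast {p : T → ℝ | (∀ t, p t ∈ Set.Icc (0 : ℝ) 1) ∧ untilOp C A B p = p}
      (fun t => C.prob t (untilPaths A B)) :=
  ⟨⟨fun _ => ⟨C.prob_nonneg _ _, C.prob_le_one _ _⟩, C.untilOp_prob_untilPaths A B⟩,
    fun _ hp t => C.prob_untilPaths_le A B (fun t => (hp.1 t).1) hp.2 t⟩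

/-- A nonnegative solution of the equation system is the vector of until probabilities, if from
every undecided state with a positive value there is a transition to the target or to a state of
smaller rank. -/
lemma DTMC.eq_prob_untilPaths_of_rank {D : Type*} [LinearOrder D] (A B : T → Prop) {p : T → ℝ}
    (hp : ∀ t, 0 ≤ p t) (hfix : untilOp C A B p = p) (d : T → D)
    (hd : ∀ t, A t → ¬ B t → 0 < p t → ∃ t', 0 < C.P t t' ∧ (B t' ∨ d t' < d t)) (t : T) :
    p t = C.prob t (untilPaths A B) := by
  set q : T → ℝ := fun t => C.prob t (untilPaths A B) with hq
  have hqfix : untilOp C A B q = q := C.untilOp_prob_untilPaths A B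
  have hle : ∀ t, q t ≤ p t := C.prob_untilPaths_le A B hp hfix
  have : Nonempty T := ⟨t⟩
  obtain ⟨m, hm⟩ := Finite.exists_max fun t => p t - q t
  by_contra hne
  have hpos : 0 < p m - q m :=
    (sub_pos.2 (lt_of_le_of_ne (hle t) (Ne.symm hne))).trans_le (hm t)
  have hundec : ∀ s, p s - q s = p m - q m → A s ∧ ¬ B s := by
    intro s hs
    have hps := congrFun hfix s
    have hqs := congrFun hqfix s
    unfold untilOp at hps hqs
    split_ifs at hps hqs with hB hA
    · linarith
    · exact ⟨hA, hB⟩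
    · linarith
  have hclosed : ∀ s, p s - q s = p m - q m → ∀ s', 0 < C.P s s' →
      p s' - q s' = p m - q m := by
    intro s hs s' hs'
    obtain ⟨hA, hB⟩ := hundec s hs
    have hps := congrFun hfix s
    have hqs := congrFun hqfix s
    simp only [untilOp, if_neg hB, if_pos hA] at hps hqs
    by_contra hlt
    have hlt' : p s' - q s' < p m - q m := lt_of_le_of_ne (hm s') hlt
    have h1 : ∑ u, C.P s u * (p u - q u) < ∑ u, C.P s u * (p m - q m) :=
      Finset.sum_lt_sum (fun u _ => mul_le_mul_of_nonneg_left (hm u) (C.nonneg s u))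
        ⟨s', Finset.mem_univ _, mul_lt_mul_of_pos_left hlt' hs'⟩
    rw [← Finset.sum_mul, C.sum_P, one_mul] at h1
    simp only [mul_sub, Finset.sum_sub_distrib] at h1
    linarith
  obtain ⟨r, hr, hmin⟩ := Set.exists_min_image {s | p s - q s = p m - q m} d
    (Set.toFinite _) ⟨m, rfl⟩
  obtain ⟨hA, hB⟩ := hundec r hr
  have hr0 : 0 < p r := by
    have : 0 ≤ q r := C.prob_nonneg _ _
    have hr' : p r - q r = p m - q m := hr
    linarith
  obtain ⟨r', hr', h⟩ := hd r hA hB hr0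
  have hmem := hclosed r hr r' hr'
  rcases h with h | h
  · exact (hundec r' hmem).2 h
  · exact absurd h (not_lt.2 (hmin r' hmem))

/-- A rank on the states of a chain that decreases along some transition from every state that can
reach `B` and is not in `B`. -/
lemma DTMC.exists_rank {D : Type*} [LinearOrder D] (e : Fin (Fintype.card T) ↪o D)
    (B : T → Prop) :
    ∃ d : T → D, ∀ (A : T → Prop) (t : T), ¬ B t → 0 < C.prob t (untilPaths A B) →
      ∃ t', 0 < C.P t t' ∧ d t' < d t := by
  classical
  let v : ℕ → T → ℝ := fun k t => C.prob t (boundedUntilPaths (fun _ => True) B 0 k)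
  let r : T → ℕ := fun t => sInf {k | 0 < v k t}
  have hcard : ∀ t, (Finset.univ.filter fun s => r s < r t).card < Fintype.card T := fun t =>
    Finset.card_lt_univ_of_notMem (x := t) (by simp)
  refine ⟨fun t => e ⟨_, hcard t⟩, fun A t hB hpos => ?_⟩
  have hpos' : 0 < C.prob t (untilPaths (fun _ => True) B) :=
    hpos.trans_le (C.prob_mono t fun π ⟨j, h, _⟩ => ⟨j, h, fun _ _ => trivial⟩)
  have hex : {k | 0 < v k t}.Nonempty :=
    ((C.tendsto_prob_boundedUntilPaths _ B t).eventually_const_lt hpos').exists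
  have hmem : 0 < v (r t) t := Nat.sInf_mem hex
  rcases hk : r t with _ | k
  · rw [hk] at hmem
    simp only [v, C.prob_boundedUntilPaths_zero_zero, if_neg hB] at hmem
    exact absurd hmem (lt_irrefl _)
  · rw [hk] at hmem
    simp only [v, C.prob_boundedUntilPaths_zero_succ, untilOp, if_neg hB, if_true] at hmem
    obtain ⟨t', -, ht'⟩ := Finset.exists_lt_of_sum_lt
      (f := fun _ => (0 : ℝ)) (by simpa using hmem)
    have hv := C.prob_nonneg t' (boundedUntilPaths (fun _ => True) B 0 k)
    have hP : 0 < C.P t t' := (C.nonneg t t').lt_of_ne' fun h => by simp [h] at ht'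
    refine ⟨t', hP, e.lt_iff_lt.2 ?_⟩
    have hlt : r t' < r t := by
      have : r t' ≤ k := Nat.sInf_le (pos_of_mul_pos_right ht' hP.le)
      omega
    refine Fin.mk_lt_mk.2 (Finset.card_lt_card ?_)
    refine Finset.ssubset_iff_subset_ne.2 ⟨fun s hs => ?_, fun h => ?_⟩
    · simp only [Finset.mem_filter, Finset.mem_univ, true_and] at hs ⊢
      omega
    · have : t' ∈ Finset.univ.filter fun s => r s < r t := by simpa using hlt
      rw [← h] at this
      simp at this

end Probabilities

section SMTLemmas

variable {S Act AP D : Type*} {n : ℕ} [LinearOrder D] (ν : Assignment S Act AP n D)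

lemma SMT.holds_conj {ι : Type*} (I : Finset ι) (F : ι → SMT S Act AP n) :
    (SMT.conj I F).Holds ν ↔ ∀ i ∈ I, (F i).Holds ν := by
  have h : ∀ l : List ι, ((l.map F).foldr SMT.and SMT.tru).Holds ν ↔ ∀ i ∈ l, (F i).Holds ν := by
    intro l
    induction l with
    | nil => simp [SMT.Holds]
    | cons a l ih => simp [SMT.Holds, ih]
  simpa [SMT.conj] using h I.toList

lemma SMT.holds_disj {ι : Type*} (I : Finset ι) (F : ι → SMT S Act AP n) :
    (SMT.disj I F).Holds ν ↔ ∃ i ∈ I, (F i).Holds ν := by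
  have h : ∀ l : List ι, ((l.map F).foldr SMT.or SMT.fls).Holds ν ↔ ∃ i ∈ l, (F i).Holds ν := by
    intro l
    induction l with
    | nil => simp [SMT.Holds]
    | cons a l ih => simp [SMT.Holds, ih]
  simpa [SMT.disj] using h I.toList

lemma holds_chosen [Fintype S] [Fintype Act] (s : Fin n → S) (α : Fin n → Act) :
    (chosen s α : SMT S Act AP n).Holds ν ↔ α = fun i => ν.sched (s i) := by
  simp only [chosen, SMT.holds_conj, SMT.Holds, Finset.mem_univ, true_implies, funext_iff]
  exact forall_congr' fun i => eq_comm

lemma holds_quantEnc [Fintype S] [Fintype Act] {m : ℕ} (Q : Fin m → Quant)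
    (F : (Fin m → S) → SMT S Act AP n) :
    (quantEnc Q F).Holds ν ↔ StatePrefix Q fun s => (F s).Holds ν := by
  induction m with
  | zero => rfl
  | succ m ih =>
    cases h : Q 0 <;> simp [quantEnc, StatePrefix, h, SMT.holds_conj, SMT.holds_disj, ih]

end SMTLemmas

section Prefix

lemma Term.eval_sum {S Act AP D : Type*} {n : ℕ} (ν : Assignment S Act AP n D) {ι : Type*}
    (I : Finset ι) (t : ι → Term S AP n) :
    (Term.sum I t).eval ν = ∑ i ∈ I, (t i).eval ν := by
  have h : ∀ l : List ι, ((l.map t).foldr Term.add (Term.const 0)).eval ν =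
      (l.map fun i => (t i).eval ν).sum := by
    intro l
    induction l with
    | nil => simp [Term.eval]
    | cons a l ih => simp [Term.eval, ih]
  rw [← Finset.sum_map_toList]
  exact h I.toList

lemma not_statePrefix_iff {S : Type*} {n : ℕ} (Q : Fin n → Quant) (p : (Fin n → S) → Prop) :
    StatePrefix (fun i => (Q i).dual) (fun s => ¬ p s) ↔ ¬ StatePrefix Q p := by
  induction n with
  | zero => rfl
  | succ m ih =>
    have hex : Quant.ex.dual = .all := rfl
    have hall : Quant.all.dual = .ex := rfl
    cases h : Q 0 <;> simp [StatePrefix, h, hex, hall, ih]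

end Prefix

section SelfComposition

variable {S Act AP D : Type*} [Fintype S] [Fintype Act] {n : ℕ}
  (M : MDP S Act AP) (σ : M.Scheduler)

lemma mem_suppVec_iff (s s' : Fin n → S) :
    s' ∈ M.suppVec s (fun i => σ.1 (s i)) ↔ 0 < (M.selfComp σ n).P s s' := by
  have hP : (M.selfComp σ n).P s s' = ∏ i, M.P (s i) (σ.1 (s i)) (s' i) := rfl
  simp only [MDP.suppVec, Fintype.mem_piFinset, MDP.supp, Finset.mem_filter, Finset.mem_univ,
    true_and, hP]
  refine ⟨fun h => Finset.prod_pos fun i _ => h i, fun h i => ?_⟩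
  exact (M.P_mem _ _ _).1.lt_of_ne' (Finset.prod_ne_zero_iff.1 h.ne' i (Finset.mem_univ i))

lemma eval_succSum (ν : Assignment S Act AP n D) (s : Fin n → S)
    (x : (Fin n → S) → Term S AP n) :
    (succSum M s (fun i => σ.1 (s i)) x).eval ν =
      ∑ s', (M.selfComp σ n).P s s' * (x s').eval ν := by
  rw [succSum, Term.eval_sum]
  simp only [Term.eval]
  refine Finset.sum_subset (Finset.subset_univ _) fun s' _ hs' => ?_
  rw [mem_suppVec_iff] at hs'
  exact mul_eq_zero_of_left (le_antisymm (not_lt.1 hs') ((M.selfComp σ n).nonneg s s')) _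

lemma scheduler_mem_enabledVec (s : Fin n → S) :
    (fun i => σ.1 (s i)) ∈ M.enabledVec s :=
  Fintype.mem_piFinset.2 fun i => σ.2 (s i)

/-- A conjunction over all choices of actions says something about the scheduled actions only. -/
lemma forall_enabledVec_iff (s : Fin n → S) (p : (Fin n → Act) → Prop) :
    (∀ α ∈ M.enabledVec s, α = (fun i => σ.1 (s i)) → p α) ↔ p fun i => σ.1 (s i) :=
  ⟨fun h => h _ (scheduler_mem_enabledVec M σ s) rfl, fun h _ _ hα => hα ▸ h⟩

lemma holds_schedulerChoice_iff [LinearOrder D] (ν : Assignment S Act AP n D) :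
    (schedulerChoice M : SMT S Act AP n).Holds ν ↔ ∃ σ : M.Scheduler, σ.1 = ν.sched := by
  simp only [schedulerChoice, SMT.holds_conj, SMT.holds_disj, SMT.Holds, Finset.mem_univ,
    true_implies]
  constructor
  · intro h
    refine ⟨⟨ν.sched, fun s => ?_⟩, rfl⟩
    obtain ⟨α, hα, hs⟩ := h s
    exact hs ▸ hα
  · rintro ⟨σ, hσ⟩ s
    exact ⟨σ.1 s, σ.2 s, by rw [hσ]⟩


end SelfComposition

section Constraints

variable {S Act AP D : Type*} [Fintype S] [Fintype Act] {n : ℕ} [LinearOrder D]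
  {M : MDP S Act AP} {σ : M.Scheduler} {ν : Assignment S Act AP n D}

lemma forall_enabledVec_chosen_iff (hσ : σ.1 = ν.sched) (s : Fin n → S) (a : Prop)
    (p : (Fin n → Act) → Prop) :
    (∀ α ∈ M.enabledVec s, a ∧ (chosen s α : SMT S Act AP n).Holds ν → p α) ↔
      (a → p fun i => σ.1 (s i)) := by
  simp only [holds_chosen, ← hσ]
  rw [← forall_enabledVec_iff M σ s fun α => a → p α]
  exact forall₂_congr fun _ _ => by tauto

lemma forall_enabledVec_chosen_iff' (hσ : σ.1 = ν.sched) (s : Fin n → S) (a b : Prop)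
    (p : (Fin n → Act) → Prop) :
    (∀ α ∈ M.enabledVec s, a ∧ b ∧ (chosen s α : SMT S Act AP n).Holds ν → p α) ↔
      (a ∧ b → p fun i => σ.1 (s i)) := by
  simpa only [and_assoc] using forall_enabledVec_chosen_iff hσ s (a ∧ b) p

lemma holds_semanticsUnboundedUntil_iff (hσ : σ.1 = ν.sched) (base : SMT S Act AP n)
    (φ₁ φ₂ : Form AP n) :
    (semanticsUnboundedUntil M base φ₁ φ₂).Holds ν ↔ base.Holds ν ∧ ∀ s,
      (ν.holds s φ₂ → ν.pr s (.prob (.unt φ₁ φ₂)) = 1) ∧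
      (¬ ν.holds s φ₁ ∧ ¬ ν.holds s φ₂ → ν.pr s (.prob (.unt φ₁ φ₂)) = 0) ∧
      (ν.holds s φ₁ ∧ ¬ ν.holds s φ₂ →
        ν.pr s (.prob (.unt φ₁ φ₂)) =
          ∑ s', (M.selfComp σ n).P s s' * ν.pr s' (.prob (.unt φ₁ φ₂)) ∧
        (0 < ν.pr s (.prob (.unt φ₁ φ₂)) →
          ∃ s', 0 < (M.selfComp σ n).P s s' ∧ (ν.holds s' φ₂ ∨ ν.dist s' φ₂ < ν.dist s φ₂))) := by
  simp only [semanticsUnboundedUntil, SMT.Holds, SMT.holds_conj, SMT.holds_disj, states,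
    Finset.mem_univ, true_implies, Term.eval, forall_enabledVec_chosen_iff' hσ,
    eval_succSum, mem_suppVec_iff, and_assoc, gt_iff_lt]

lemma holds_semanticsBoundedUntil_zero_iff (base : SMT S Act AP n) (φ₁ φ₂ : Form AP n)
    (k₁ : ℕ) (hk : k₁ ≤ 0) :
    (semanticsBoundedUntil M base φ₁ φ₂ k₁ 0 hk).Holds ν ↔ base.Holds ν ∧ ∀ s,
      (ν.holds s φ₂ → ν.pr s (.prob (.bunt φ₁ φ₂ k₁ 0 hk)) = 1) ∧
      (¬ ν.holds s φ₂ → ν.pr s (.prob (.bunt φ₁ φ₂ k₁ 0 hk)) = 0) := by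
  simp only [semanticsBoundedUntil, SMT.Holds, SMT.holds_conj, states, Finset.mem_univ,
    true_implies, Term.eval]

lemma holds_semanticsBoundedUntil_zero_succ_iff (hσ : σ.1 = ν.sched) (base : SMT S Act AP n)
    (φ₁ φ₂ : Form AP n) (k : ℕ) (hk : 0 ≤ k + 1) :
    (semanticsBoundedUntil M base φ₁ φ₂ 0 (k + 1) hk).Holds ν ↔
      (semanticsBoundedUntil M base φ₁ φ₂ 0 k (Nat.zero_le k)).Holds ν ∧ ∀ s,
      (ν.holds s φ₂ → ν.pr s (.prob (.bunt φ₁ φ₂ 0 (k + 1) hk)) = 1) ∧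
      (¬ ν.holds s φ₁ ∧ ¬ ν.holds s φ₂ → ν.pr s (.prob (.bunt φ₁ φ₂ 0 (k + 1) hk)) = 0) ∧
      (ν.holds s φ₁ ∧ ¬ ν.holds s φ₂ → ν.pr s (.prob (.bunt φ₁ φ₂ 0 (k + 1) hk)) =
        ∑ s', (M.selfComp σ n).P s s' * ν.pr s' (.prob (.bunt φ₁ φ₂ 0 k (Nat.zero_le k)))) := by
  simp only [semanticsBoundedUntil, SMT.Holds, SMT.holds_conj, states,
    Finset.mem_univ, true_implies, Term.eval, forall_enabledVec_chosen_iff' hσ,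
    eval_succSum, and_assoc]

lemma holds_semanticsBoundedUntil_succ_succ_iff (hσ : σ.1 = ν.sched) (base : SMT S Act AP n)
    (φ₁ φ₂ : Form AP n) (k₁ k₂ : ℕ) (hk : k₁ + 1 ≤ k₂ + 1) :
    (semanticsBoundedUntil M base φ₁ φ₂ (k₁ + 1) (k₂ + 1) hk).Holds ν ↔
      (semanticsBoundedUntil M base φ₁ φ₂ k₁ k₂ (Nat.le_of_succ_le_succ hk)).Holds ν ∧ ∀ s,
      (¬ ν.holds s φ₁ → ν.pr s (.prob (.bunt φ₁ φ₂ (k₁ + 1) (k₂ + 1) hk)) = 0) ∧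
      (ν.holds s φ₁ → ν.pr s (.prob (.bunt φ₁ φ₂ (k₁ + 1) (k₂ + 1) hk)) =
        ∑ s', (M.selfComp σ n).P s s' *
          ν.pr s' (.prob (.bunt φ₁ φ₂ k₁ k₂ (Nat.le_of_succ_le_succ hk)))) := by
  simp only [semanticsBoundedUntil, SMT.Holds, SMT.holds_conj, states,
    Finset.mem_univ, true_implies, Term.eval,
    forall_enabledVec_chosen_iff hσ, eval_succSum]

lemma holds_semantics_next_iff (hσ : σ.1 = ν.sched) (φ : Form AP n) :
    (PathForm.semantics M (.next φ)).Holds ν ↔ (φ.semantics M).Holds ν ∧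
      (∀ s, ν.toInt s φ = 1 ∧ ν.holds s φ ∨ ν.toInt s φ = 0 ∧ ¬ ν.holds s φ) ∧
      ∀ s, ν.pr s (.prob (.next φ)) = ∑ s', (M.selfComp σ n).P s s' * ν.toInt s' φ := by
  simp only [PathForm.semantics, SMT.Holds, SMT.holds_conj, states, Finset.mem_univ,
    true_implies, Term.eval, holds_chosen, ← hσ, forall_enabledVec_iff, eval_succSum, and_assoc]

/-- The constraints for a bounded until contain the constraints of its operands. -/
lemma base_of_holds_semanticsBoundedUntil (hσ : σ.1 = ν.sched) {base : SMT S Act AP n}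
    {φ₁ φ₂ : Form AP n} {k₁ k₂ : ℕ} {hk : k₁ ≤ k₂}
    (h : (semanticsBoundedUntil M base φ₁ φ₂ k₁ k₂ hk).Holds ν) : base.Holds ν := by
  induction k₂ generalizing k₁ with
  | zero => exact ((holds_semanticsBoundedUntil_zero_iff ..).1 h).1
  | succ k₂ ih =>
    cases k₁ with
    | zero => exact ih ((holds_semanticsBoundedUntil_zero_succ_iff hσ ..).1 h).1
    | succ k₁ => exact ih ((holds_semanticsBoundedUntil_succ_succ_iff hσ ..).1 h).1

end Constraints

section Soundness

variable {S Act AP D : Type*} [Fintype S] [Fintype Act] {n : ℕ} [LinearOrder D]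
  {M : MDP S Act AP} {σ : M.Scheduler} {ν : Assignment S Act AP n D}

lemma pr_unt_eq_of_holds (hσ : σ.1 = ν.sched) {base : SMT S Act AP n} {φ₁ φ₂ : Form AP n}
    (h₁ : ∀ s, ν.holds s φ₁ ↔ φ₁.Sat (M.selfComp σ n) s)
    (h₂ : ∀ s, ν.holds s φ₂ ↔ φ₂.Sat (M.selfComp σ n) s)
    (h : (semanticsUnboundedUntil M base φ₁ φ₂).Holds ν) (s : Fin n → S) :
    ν.pr s (.prob (.unt φ₁ φ₂)) = (M.selfComp σ n).prob s
      (untilPaths (φ₁.Sat (M.selfComp σ n)) (φ₂.Sat (M.selfComp σ n))) := by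
  rw [holds_semanticsUnboundedUntil_iff hσ] at h
  simp only [h₁, h₂] at h
  refine DTMC.eq_prob_untilPaths_of_rank (p := fun s => ν.pr s (.prob (.unt φ₁ φ₂))) _ _ _
    (fun s => (ν.pr_mem s _).1) (funext fun s => ?_) (fun s => ν.dist s φ₂)
    (fun s hA hB => ((h.2 s).2.2 ⟨hA, hB⟩).2) s
  unfold untilOp
  split_ifs with hB hA
  · exact ((h.2 s).1 hB).symm
  · exact ((h.2 s).2.2 ⟨hA, hB⟩).1.symm
  · exact ((h.2 s).2.1 ⟨hA, hB⟩).symm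

lemma pr_bunt_eq_of_holds (hσ : σ.1 = ν.sched) {base : SMT S Act AP n} {φ₁ φ₂ : Form AP n}
    (h₁ : ∀ s, ν.holds s φ₁ ↔ φ₁.Sat (M.selfComp σ n) s)
    (h₂ : ∀ s, ν.holds s φ₂ ↔ φ₂.Sat (M.selfComp σ n) s) {k₁ k₂ : ℕ} {hk : k₁ ≤ k₂}
    (h : (semanticsBoundedUntil M base φ₁ φ₂ k₁ k₂ hk).Holds ν) (s : Fin n → S) :
    ν.pr s (.prob (.bunt φ₁ φ₂ k₁ k₂ hk)) = (M.selfComp σ n).prob s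
      (boundedUntilPaths (φ₁.Sat (M.selfComp σ n)) (φ₂.Sat (M.selfComp σ n)) k₁ k₂) := by
  induction k₂ generalizing k₁ s with
  | zero =>
    obtain rfl := Nat.le_zero.1 hk
    rw [holds_semanticsBoundedUntil_zero_iff] at h
    simp only [h₂] at h
    rw [DTMC.prob_boundedUntilPaths_zero_zero]
    split_ifs with hB
    · exact (h.2 s).1 hB
    · exact (h.2 s).2 hB
  | succ k₂ ih =>
    cases k₁ with
    | zero =>
      rw [holds_semanticsBoundedUntil_zero_succ_iff hσ] at h
      simp only [h₁, h₂] at h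
      simp only [ih h.1] at h
      rw [DTMC.prob_boundedUntilPaths_zero_succ, untilOp]
      split_ifs with hB hA
      · exact (h.2 s).1 hB
      · exact (h.2 s).2.2 ⟨hA, hB⟩
      · exact (h.2 s).2.1 ⟨hA, hB⟩
    | succ k₁ =>
      rw [holds_semanticsBoundedUntil_succ_succ_iff hσ] at h
      simp only [h₁] at h
      simp only [ih h.1] at h
      rw [DTMC.prob_boundedUntilPaths_succ_succ]
      split_ifs with hA
      · exact (h.2 s).2 hA
      · exact (h.2 s).1 hA

mutual

/-- The constraints determine the propositions `holds`. -/
theorem Form.holds_iff_of_semantics (hσ : σ.1 = ν.sched) :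
    ∀ φ : Form AP n, (φ.semantics M).Holds ν →
      ∀ s, ν.holds s φ ↔ φ.Sat (M.selfComp σ n) s
  | .tru, h, s => by
    simp only [Form.semantics, SMT.holds_conj, states, Finset.mem_univ, true_implies,
      SMT.Holds] at h
    simp [Form.Sat, h s]
  | .atom a i, h, s => by
    simp only [Form.semantics, SMT.Holds, SMT.holds_conj, statesWith, Finset.mem_filter,
      Finset.mem_univ, true_and] at h
    simp only [Form.Sat]
    change _ ↔ a ∈ M.L (s i)
    by_cases ha : a ∈ M.L (s i)
    · simp [ha, h.1 s ha]
    · simp [ha, h.2 s ha]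
  | .and φ₁ φ₂, h, s => by
    simp only [Form.semantics, SMT.Holds, SMT.holds_conj, states, Finset.mem_univ,
      true_implies] at h
    have h₁ := φ₁.holds_iff_of_semantics hσ h.1.1 s
    have h₂ := φ₂.holds_iff_of_semantics hσ h.1.2 s
    have := h.2 s
    simp only [Form.Sat]
    tauto
  | .neg φ, h, s => by
    simp only [Form.semantics, SMT.Holds, SMT.holds_conj, states, Finset.mem_univ,
      true_implies] at h
    have h₁ := φ.holds_iff_of_semantics hσ h.1 s
    have := h.2 s
    simp only [Form.Sat, Xor] at this ⊢
    tauto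
  | .lt e₁ e₂, h, s => by
    simp only [Form.semantics, SMT.Holds, SMT.holds_conj, states, Finset.mem_univ,
      true_implies, Term.eval] at h
    have h₁ := e₁.pr_eq_of_semantics hσ h.1.1 s
    have h₂ := e₂.pr_eq_of_semantics hσ h.1.2 s
    have := h.2 s
    simp only [Form.Sat, ← h₁, ← h₂]
    rw [ge_iff_le, ← not_lt] at this
    tauto

/-- The constraints determine the values of expressions. -/
theorem Expr.pr_eq_of_semantics (hσ : σ.1 = ν.sched) :
    ∀ e : Expr AP n, (e.semantics M).Holds ν → ∀ s, ν.pr s e = e.val (M.selfComp σ n) s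
  | .prob ψ, h, s => by
    simp only [Expr.semantics] at h
    rw [ψ.pr_eq_of_semantics hσ h s, Expr.val]
  | .const c, h, s => by
    simp only [Expr.semantics, SMT.Holds, SMT.holds_conj, states, Finset.mem_univ,
      true_implies, Term.eval] at h
    rw [h s, Expr.val]
  | .add e₁ e₂, h, s => by
    simp only [Expr.semantics, SMT.Holds, SMT.holds_conj, states, Finset.mem_univ,
      true_implies, Term.eval] at h
    rw [h.2 s, e₁.pr_eq_of_semantics hσ h.1.1 s, e₂.pr_eq_of_semantics hσ h.1.2 s, Expr.val]
  | .sub e₁ e₂, h, s => by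
    simp only [Expr.semantics, SMT.Holds, SMT.holds_conj, states, Finset.mem_univ,
      true_implies, Term.eval] at h
    rw [h.2 s, e₁.pr_eq_of_semantics hσ h.1.1 s, e₂.pr_eq_of_semantics hσ h.1.2 s, Expr.val]
  | .mul e₁ e₂, h, s => by
    simp only [Expr.semantics, SMT.Holds, SMT.holds_conj, states, Finset.mem_univ,
      true_implies, Term.eval] at h
    rw [h.2 s, e₁.pr_eq_of_semantics hσ h.1.1 s, e₂.pr_eq_of_semantics hσ h.1.2 s, Expr.val]

/-- The constraints determine the probabilities of path formulas. -/
theorem PathForm.pr_eq_of_semantics (hσ : σ.1 = ν.sched) :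
    ∀ ψ : PathForm AP n, (ψ.semantics M).Holds ν →
      ∀ s, ν.pr s (.prob ψ) = (M.selfComp σ n).prob s {π | ψ.Sat (M.selfComp σ n) π}
  | .next φ, h, s => by
    classical
    rw [holds_semantics_next_iff hσ] at h
    have h₁ := φ.holds_iff_of_semantics hσ h.1
    simp only [PathForm.Sat]
    rw [h.2.2 s, DTMC.prob_next]
    refine Finset.sum_congr rfl fun s' _ => congrArg _ ?_
    rcases h.2.1 s' with ⟨ht, hs⟩ | ⟨ht, hs⟩ <;> rw [h₁] at hs <;> simp [ht, hs]
  | .unt φ₁ φ₂, h, s => by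
    simp only [PathForm.semantics] at h
    have hb := ((holds_semanticsUnboundedUntil_iff hσ ..).1 h).1
    simp only [SMT.Holds] at hb
    simp only [PathForm.Sat]
    exact pr_unt_eq_of_holds hσ (φ₁.holds_iff_of_semantics hσ hb.1)
      (φ₂.holds_iff_of_semantics hσ hb.2) h s
  | .bunt φ₁ φ₂ k₁ k₂ hk, h, s => by
    simp only [PathForm.semantics] at h
    have hb := base_of_holds_semanticsBoundedUntil hσ h
    simp only [SMT.Holds] at hb
    simp only [PathForm.Sat]
    exact pr_bunt_eq_of_holds hσ (φ₁.holds_iff_of_semantics hσ hb.1)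
      (φ₂.holds_iff_of_semantics hσ hb.2) h s

end

mutual

/-- The constraints of a formula contain those of the unbounded untils that occur in it. -/
theorem Form.holds_semantics_of_mem_untils (hσ : σ.1 = ν.sched) {φ₁ φ₂ : Form AP n} :
    ∀ φ : Form AP n, (φ.semantics M).Holds ν → (φ₁, φ₂) ∈ φ.untils →
      (PathForm.semantics M (.unt φ₁ φ₂)).Holds ν
  | .tru, _, hm => by simp [Form.untils] at hm
  | .atom _ _, _, hm => by simp [Form.untils] at hm
  | .and χ₁ χ₂, h, hm => by
    simp only [Form.semantics, SMT.Holds] at h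
    simp only [Form.untils] at hm
    exact hm.elim (Form.holds_semantics_of_mem_untils hσ χ₁ h.1.1)
      (Form.holds_semantics_of_mem_untils hσ χ₂ h.1.2)
  | .neg χ, h, hm => by
    simp only [Form.semantics, SMT.Holds] at h
    simp only [Form.untils] at hm
    exact Form.holds_semantics_of_mem_untils hσ χ h.1 hm
  | .lt e₁ e₂, h, hm => by
    simp only [Form.semantics, SMT.Holds] at h
    simp only [Form.untils] at hm
    exact hm.elim (e₁.holds_semantics_of_mem_untils hσ h.1.1)
      (e₂.holds_semantics_of_mem_untils hσ h.1.2)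

/-- The constraints of an expression contain those of the unbounded untils that occur in it. -/
theorem Expr.holds_semantics_of_mem_untils (hσ : σ.1 = ν.sched) {φ₁ φ₂ : Form AP n} :
    ∀ e : Expr AP n, (e.semantics M).Holds ν → (φ₁, φ₂) ∈ e.untils →
      (PathForm.semantics M (.unt φ₁ φ₂)).Holds ν
  | .prob ψ, h, hm => by
    simp only [Expr.semantics] at h
    simp only [Expr.untils] at hm
    exact ψ.holds_semantics_of_mem_untils hσ h hm
  | .const _, _, hm => by simp [Expr.untils] at hm
  | .add e₁ e₂, h, hm => by
    simp only [Expr.semantics, SMT.Holds] at h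
    simp only [Expr.untils] at hm
    exact hm.elim (e₁.holds_semantics_of_mem_untils hσ h.1.1)
      (e₂.holds_semantics_of_mem_untils hσ h.1.2)
  | .sub e₁ e₂, h, hm => by
    simp only [Expr.semantics, SMT.Holds] at h
    simp only [Expr.untils] at hm
    exact hm.elim (e₁.holds_semantics_of_mem_untils hσ h.1.1)
      (e₂.holds_semantics_of_mem_untils hσ h.1.2)
  | .mul e₁ e₂, h, hm => by
    simp only [Expr.semantics, SMT.Holds] at h
    simp only [Expr.untils] at hm
    exact hm.elim (e₁.holds_semantics_of_mem_untils hσ h.1.1)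
      (e₂.holds_semantics_of_mem_untils hσ h.1.2)

/-- The constraints of a path formula contain those of the unbounded untils that occur in it. -/
theorem PathForm.holds_semantics_of_mem_untils (hσ : σ.1 = ν.sched) {φ₁ φ₂ : Form AP n} :
    ∀ ψ : PathForm AP n, (ψ.semantics M).Holds ν → (φ₁, φ₂) ∈ ψ.untils →
      (PathForm.semantics M (.unt φ₁ φ₂)).Holds ν
  | .next φ, h, hm => by
    simp only [PathForm.untils] at hm
    exact Form.holds_semantics_of_mem_untils hσ φ ((holds_semantics_next_iff hσ φ).1 h).1 hm
  | .unt χ₁ χ₂, h, hm => by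
    simp only [PathForm.untils, Set.mem_insert_iff, Prod.mk.injEq] at hm
    rcases hm with ⟨rfl, rfl⟩ | hm
    · exact h
    · simp only [PathForm.semantics] at h
      have hb := ((holds_semanticsUnboundedUntil_iff hσ ..).1 h).1
      simp only [SMT.Holds] at hb
      exact hm.elim (Form.holds_semantics_of_mem_untils hσ χ₁ hb.1)
        (Form.holds_semantics_of_mem_untils hσ χ₂ hb.2)
  | .bunt χ₁ χ₂ k₁ k₂ hk, h, hm => by
    simp only [PathForm.untils] at hm
    simp only [PathForm.semantics] at h
    have hb := base_of_holds_semanticsBoundedUntil hσ h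
    simp only [SMT.Holds] at hb
    exact hm.elim (Form.holds_semantics_of_mem_untils hσ χ₁ hb.1)
      (Form.holds_semantics_of_mem_untils hσ χ₂ hb.2)

end

end Soundness

section Completeness

variable {S Act AP D : Type*} [Fintype S] [Fintype Act] {n : ℕ}
  {M : MDP S Act AP}

open Classical in
/-- The assignment that interprets the variables by the semantics under the scheduler `σ`, with
given distances. -/
noncomputable def canonicalAssignment (M : MDP S Act AP) (σ : M.Scheduler)
    (d : (Fin n → S) → Form AP n → D) : Assignment S Act AP n D where
  sched := σ.1
  holds s φ := φ.Sat (M.selfComp σ n) s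
  pr s e := e.val (M.selfComp σ n) s
  pr_mem s ψ := by
    rw [Expr.val]
    exact ⟨DTMC.prob_nonneg _ _ _, DTMC.prob_le_one _ _ _⟩
  toInt s φ := if φ.Sat (M.selfComp σ n) s then 1 else 0
  toInt_mem s φ := by split_ifs <;> simp
  dist := d

variable {σ : M.Scheduler} {d : (Fin n → S) → Form AP n → D}

lemma canonicalAssignment_pr_unt (φ₁ φ₂ : Form AP n) (s : Fin n → S) :
    (canonicalAssignment M σ d).pr s (.prob (.unt φ₁ φ₂)) = (M.selfComp σ n).prob s
      (untilPaths (φ₁.Sat (M.selfComp σ n)) (φ₂.Sat (M.selfComp σ n))) := by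
  simp only [canonicalAssignment, Expr.val, PathForm.Sat]
  rfl

lemma canonicalAssignment_pr_bunt (φ₁ φ₂ : Form AP n) (k₁ k₂ : ℕ) (hk : k₁ ≤ k₂)
    (s : Fin n → S) :
    (canonicalAssignment M σ d).pr s (.prob (.bunt φ₁ φ₂ k₁ k₂ hk)) = (M.selfComp σ n).prob s
      (boundedUntilPaths (φ₁.Sat (M.selfComp σ n)) (φ₂.Sat (M.selfComp σ n)) k₁ k₂) := by
  simp only [canonicalAssignment, Expr.val, PathForm.Sat]
  rfl

lemma canonicalAssignment_holds (φ : Form AP n) (s : Fin n → S) :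
    (canonicalAssignment M σ d).holds s φ ↔ φ.Sat (M.selfComp σ n) s := Iff.rfl

variable [LinearOrder D]

/-- From every state outside `φ` that reaches `φ` with positive probability, the distance to `φ`
decreases along some transition. -/
def DecreasesAlongSteps (M : MDP S Act AP) (σ : M.Scheduler)
    (d : (Fin n → S) → Form AP n → D) : Prop :=
  ∀ (A : (Fin n → S) → Prop) (φ : Form AP n) (s : Fin n → S), ¬ φ.Sat (M.selfComp σ n) s →
    0 < (M.selfComp σ n).prob s (untilPaths A (φ.Sat (M.selfComp σ n))) →
    ∃ s', 0 < (M.selfComp σ n).P s s' ∧ d s' φ < d s φ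

lemma canonicalAssignment_unboundedUntil (hd : DecreasesAlongSteps M σ d)
    {base : SMT S Act AP n} (hb : base.Holds (canonicalAssignment M σ d)) (φ₁ φ₂ : Form AP n) :
    (semanticsUnboundedUntil M base φ₁ φ₂).Holds (canonicalAssignment M σ d) := by
  rw [holds_semanticsUnboundedUntil_iff rfl]
  refine ⟨hb, fun s => ?_⟩
  simp only [canonicalAssignment_pr_unt, canonicalAssignment_holds]
  have hfix := congrFun ((M.selfComp σ n).untilOp_prob_untilPaths
    (φ₁.Sat (M.selfComp σ n)) (φ₂.Sat (M.selfComp σ n))) s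
  refine ⟨fun hB => ?_, fun ⟨hA, hB⟩ => ?_, fun ⟨hA, hB⟩ => ⟨?_, fun hpos => ?_⟩⟩
  · rw [← hfix, untilOp, if_pos hB]
  · rw [← hfix, untilOp, if_neg hB, if_neg hA]
  · rw [← hfix, untilOp, if_neg hB, if_pos hA]
  · obtain ⟨s', hP, hlt⟩ := hd _ φ₂ s hB hpos
    exact ⟨s', hP, .inr hlt⟩

lemma canonicalAssignment_boundedUntil {base : SMT S Act AP n}
    (hb : base.Holds (canonicalAssignment M σ d)) (φ₁ φ₂ : Form AP n) (k₁ k₂ : ℕ) (hk : k₁ ≤ k₂) :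
    (semanticsBoundedUntil M base φ₁ φ₂ k₁ k₂ hk).Holds (canonicalAssignment M σ d) := by
  induction k₂ generalizing k₁ with
  | zero =>
    obtain rfl := Nat.le_zero.1 hk
    rw [holds_semanticsBoundedUntil_zero_iff]
    refine ⟨hb, fun s => ?_⟩
    simp only [canonicalAssignment_pr_bunt, canonicalAssignment_holds,
      DTMC.prob_boundedUntilPaths_zero_zero]
    exact ⟨fun hB => if_pos hB, fun hB => if_neg hB⟩
  | succ k₂ ih =>
    cases k₁ with
    | zero =>
      rw [holds_semanticsBoundedUntil_zero_succ_iff rfl]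
      refine ⟨ih 0 _, fun s => ?_⟩
      simp only [canonicalAssignment_pr_bunt, canonicalAssignment_holds,
        DTMC.prob_boundedUntilPaths_zero_succ, untilOp]
      refine ⟨fun hB => if_pos hB, fun ⟨hA, hB⟩ => ?_, fun ⟨hA, hB⟩ => ?_⟩
      · rw [if_neg hB, if_neg hA]
      · rw [if_neg hB, if_pos hA]
    | succ k₁ =>
      rw [holds_semanticsBoundedUntil_succ_succ_iff rfl]
      refine ⟨ih k₁ _, fun s => ?_⟩
      simp only [canonicalAssignment_pr_bunt, canonicalAssignment_holds,
        DTMC.prob_boundedUntilPaths_succ_succ]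
      exact ⟨fun hA => if_neg hA, fun hA => if_pos hA⟩

mutual

theorem Form.canonicalAssignment_semantics (hd : DecreasesAlongSteps M σ d) :
    ∀ φ : Form AP n, (φ.semantics M).Holds (canonicalAssignment M σ d)
  | .tru => by
    simp [Form.semantics, SMT.holds_conj, SMT.Holds, canonicalAssignment_holds, Form.Sat]
  | .atom a i => by
    simp only [Form.semantics, SMT.Holds, SMT.holds_conj, statesWith, Finset.mem_filter,
      Finset.mem_univ, true_and, canonicalAssignment_holds, Form.Sat]
    exact ⟨fun _ h => h, fun _ h => h⟩
  | .and φ₁ φ₂ => by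
    simp only [Form.semantics, SMT.Holds, SMT.holds_conj, canonicalAssignment_holds, Form.Sat]
    refine ⟨⟨Form.canonicalAssignment_semantics hd φ₁,
      Form.canonicalAssignment_semantics hd φ₂⟩, fun s _ => ?_⟩
    tauto
  | .neg φ => by
    simp only [Form.semantics, SMT.Holds, SMT.holds_conj, canonicalAssignment_holds, Form.Sat]
    refine ⟨Form.canonicalAssignment_semantics hd φ, fun s _ => ?_⟩
    unfold Xor
    tauto
  | .lt e₁ e₂ => by
    simp only [Form.semantics, SMT.Holds, SMT.holds_conj, canonicalAssignment_holds, Form.Sat,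
      Term.eval]
    refine ⟨⟨Expr.canonicalAssignment_semantics hd e₁,
      Expr.canonicalAssignment_semantics hd e₂⟩, fun s _ => ?_⟩
    simp only [canonicalAssignment]
    rw [ge_iff_le, ← not_lt]
    tauto

theorem Expr.canonicalAssignment_semantics (hd : DecreasesAlongSteps M σ d) :
    ∀ e : Expr AP n, (e.semantics M).Holds (canonicalAssignment M σ d)
  | .prob ψ => by
    simp only [Expr.semantics]
    exact PathForm.canonicalAssignment_semantics hd ψ
  | .const c => by
    simp [Expr.semantics, SMT.holds_conj, SMT.Holds, canonicalAssignment, Expr.val, Term.eval]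
  | .add e₁ e₂ => by
    simp only [Expr.semantics, SMT.Holds, SMT.holds_conj, Term.eval]
    refine ⟨⟨Expr.canonicalAssignment_semantics hd e₁,
      Expr.canonicalAssignment_semantics hd e₂⟩, fun s _ => ?_⟩
    simp only [canonicalAssignment, Expr.val]
  | .sub e₁ e₂ => by
    simp only [Expr.semantics, SMT.Holds, SMT.holds_conj, Term.eval]
    refine ⟨⟨Expr.canonicalAssignment_semantics hd e₁,
      Expr.canonicalAssignment_semantics hd e₂⟩, fun s _ => ?_⟩
    simp only [canonicalAssignment, Expr.val]
  | .mul e₁ e₂ => by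
    simp only [Expr.semantics, SMT.Holds, SMT.holds_conj, Term.eval]
    refine ⟨⟨Expr.canonicalAssignment_semantics hd e₁,
      Expr.canonicalAssignment_semantics hd e₂⟩, fun s _ => ?_⟩
    simp only [canonicalAssignment, Expr.val]

theorem PathForm.canonicalAssignment_semantics (hd : DecreasesAlongSteps M σ d) :
    ∀ ψ : PathForm AP n, (ψ.semantics M).Holds (canonicalAssignment M σ d)
  | .next φ => by
    rw [holds_semantics_next_iff (σ := σ) rfl]
    refine ⟨Form.canonicalAssignment_semantics hd φ, fun s => ?_, fun s => ?_⟩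
    · by_cases h : φ.Sat (M.selfComp σ n) s <;> simp [canonicalAssignment, h]
    · simp only [canonicalAssignment, Expr.val, PathForm.Sat]
      exact DTMC.prob_next _ s _
  | .unt φ₁ φ₂ => by
    simp only [PathForm.semantics]
    refine canonicalAssignment_unboundedUntil hd ?_ φ₁ φ₂
    simp only [SMT.Holds]
    exact ⟨Form.canonicalAssignment_semantics hd φ₁, Form.canonicalAssignment_semantics hd φ₂⟩
  | .bunt φ₁ φ₂ k₁ k₂ hk => by
    simp only [PathForm.semantics]
    refine canonicalAssignment_boundedUntil ?_ φ₁ φ₂ k₁ k₂ hk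
    simp only [SMT.Holds]
    exact ⟨Form.canonicalAssignment_semantics hd φ₁, Form.canonicalAssignment_semantics hd φ₂⟩

end

/-- For every scheduler the constraints have a solution that chooses this scheduler. -/
theorem exists_assignment_semantics (hD : Nonempty (Fin (Fintype.card S ^ n) ↪o D))
    (M : MDP S Act AP) (σ : M.Scheduler) :
    ∃ ν : Assignment S Act AP n D, σ.1 = ν.sched ∧
      ∀ φ : Form AP n, (φ.semantics M).Holds ν := by
  obtain ⟨e⟩ := hD
  have hcard : Fintype.card (Fin n → S) = Fintype.card S ^ n := by simp
  choose d hd using fun φ : Form AP n =>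
    (M.selfComp σ n).exists_rank ((Fin.castOrderIso hcard).toOrderEmbedding.trans e)
      (φ.Sat (M.selfComp σ n))
  exact ⟨canonicalAssignment M σ fun s φ => d φ s, rfl,
    Form.canonicalAssignment_semantics fun A φ s => hd φ A s⟩

/-- Satisfiability of the encoding of `∃ σ̂. Q_1 ŝ_1(σ̂). … Q_n ŝ_n(σ̂). φ`. -/
theorem satisfiable_encoding_iff (hD : Nonempty (Fin (Fintype.card S ^ n) ↪o D))
    (M : MDP S Act AP) (Q : Fin n → Quant) (φ : Form AP n) :
    (SMT.and (.and (schedulerChoice M) (φ.semantics M)) (truthEnc Q φ)).Satisfiable D ↔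
      ∃ σ : M.Scheduler, StatePrefix Q fun s => φ.Sat (M.selfComp σ n) s := by
  constructor
  · rintro ⟨ν, ⟨hs, hφ⟩, ht⟩
    obtain ⟨σ, hσ⟩ := (holds_schedulerChoice_iff M ν).1 hs
    refine ⟨σ, ?_⟩
    rw [truthEnc, holds_quantEnc] at ht
    simpa only [SMT.Holds, φ.holds_iff_of_semantics hσ hφ] using ht
  · rintro ⟨σ, h⟩
    obtain ⟨ν, hσ, hν⟩ := exists_assignment_semantics hD M σ
    refine ⟨ν, ⟨(holds_schedulerChoice_iff M ν).2 ⟨σ, hσ⟩, hν φ⟩, ?_⟩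
    rw [truthEnc, holds_quantEnc]
    simpa only [SMT.Holds, φ.holds_iff_of_semantics hσ (hν φ)] using h

theorem satisfiable_encoding_of_ex (hD : Nonempty (Fin (Fintype.card S ^ n) ↪o D))
    (M : MDP S Act AP) (Φ : Formula AP n) (hΦ : Φ.schedQ = .ex) :
    (encoding M Φ).Satisfiable D ↔ M.Satisfies Φ := by
  simp only [encoding, MDP.Satisfies, hΦ]
  exact satisfiable_encoding_iff hD M Φ.stateQ Φ.body

theorem not_satisfiable_encoding_of_all (hD : Nonempty (Fin (Fintype.card S ^ n) ↪o D))
    (M : MDP S Act AP) (Φ : Formula AP n) (hΦ : Φ.schedQ = .all) :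
    ¬ (encoding M Φ).Satisfiable D ↔ M.Satisfies Φ := by
  simp only [encoding, MDP.Satisfies, hΦ]
  rw [satisfiable_encoding_iff hD M]
  simp only [Form.Sat, not_statePrefix_iff, not_exists, not_not]

theorem holds_semantics_body_of_holds_encoding {M : MDP S Act AP} {Φ : Formula AP n}
    {ν : Assignment S Act AP n D} (h : (encoding M Φ).Holds ν) :
    (∃ σ : M.Scheduler, σ.1 = ν.sched) ∧ (Φ.body.semantics M).Holds ν := by
  rw [← holds_schedulerChoice_iff]
  cases hΦ : Φ.schedQ
  · simp only [encoding, hΦ, SMT.Holds] at h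
    exact h.1
  · simp only [encoding, hΦ, Form.semantics, SMT.Holds] at h
    exact ⟨h.1.1, h.1.2.1⟩

end Completeness

end HyperPCTL

open HyperPCTL in
theorem mainTheorem1 {S Act AP D : Type*} [Fintype S] [Nonempty S] [Fintype Act] [LinearOrder D]
    {n : ℕ} (hD : Nonempty (Fin (Fintype.card S ^ n) ↪o D))
    (M : MDP S Act AP) (Φ : Formula AP n) :
    (mainAlgorithm D M Φ = true ↔ M.Satisfies Φ) ∧
    (Φ.schedQ = .ex → ((encoding M Φ).Satisfiable D ↔ M.Satisfies Φ)) ∧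
    (Φ.schedQ = .all → (¬ (encoding M Φ).Satisfiable D ↔ M.Satisfies Φ)) ∧
    (∀ ν : Assignment S Act AP n D, (encoding M Φ).Holds ν →
      ∃ σ : M.Scheduler, σ.1 = ν.sched ∧
        ∀ φ₁ φ₂ : Form AP n, (φ₁, φ₂) ∈ Φ.body.untils →
          IsLeast
            {p : (Fin n → S) → ℝ | (∀ s, p s ∈ Set.Icc (0 : ℝ) 1) ∧
              untilOp (M.selfComp σ n) (φ₁.Sat (M.selfComp σ n)) (φ₂.Sat (M.selfComp σ n)) p = p}
            (fun s => ν.pr s (.prob (.unt φ₁ φ₂))) ∧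
          ∀ s, ν.pr s (.prob (.unt φ₁ φ₂)) =
            (M.selfComp σ n).prob s {π | (PathForm.unt φ₁ φ₂).Sat (M.selfComp σ n) π}) := by
  refine ⟨?_, satisfiable_encoding_of_ex hD M Φ, not_satisfiable_encoding_of_all hD M Φ,
    fun ν hν => ?_⟩
  · cases hΦ : Φ.schedQ
    · rw [← satisfiable_encoding_of_ex hD M Φ hΦ]
      simp [mainAlgorithm, hΦ]
    · rw [← not_satisfiable_encoding_of_all hD M Φ hΦ]
      simp [mainAlgorithm, hΦ]
  · obtain ⟨⟨σ, hσ⟩, hbody⟩ := holds_semantics_body_of_holds_encoding hν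
    refine ⟨σ, hσ, fun φ₁ φ₂ hmem => ?_⟩
    have hpr := PathForm.pr_eq_of_semantics hσ (.unt φ₁ φ₂)
      (Form.holds_semantics_of_mem_untils hσ Φ.body hbody hmem)
    refine ⟨?_, hpr⟩
    simp only [hpr, PathForm.Sat]
    exact DTMC.isLeast_prob_untilPaths _ _ _
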